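/- For $L\in\mathbb N$ let $\Omega_L$ be the (finite) set of $L$-step prudent paths on $\mathbb Z^2$, i.e. sequences $(\pi_0,\dots,\pi_L)$ in $\mathbb Z^2$ with $\pi_0=(0,0)$, $\pi_{i+1}-\pi_i\in\{(\pm1,0),(0,\pm1)\}$, and $\pi_i+n(\pi_{i+1}-\pi_i)\notin\{\pi_0,\dots,\pi_i\}$ for all $0\le i<L$ and all integers $n\ge1$. Let $\mathbf P_{\mathrm{unif},L}$ be the uniform probability measure on $\Omega_L$, and for $\pi\in\Omega_L$ let $$\tilde\pi^L_t=\frac1L\Big(\pi_{\lfloor tL\rfloor}+(tL-\lfloor tL\rfloor)\big(\pi_{\lfloor tL\rfloor+1}-\pi_{\lfloor tL\rfloor}\big)\Big),\qquad t\in[0,1],$$ (with the second term read as $0$ at $t=1$) be the rescaled, linearly interpolated path in $\mathbb R^2$. Put $\vec e_1=(1,1)$, $\vec e_2=(-1,1)$, $\vec e_3=(-1,-1)$, $\vec e_4=(1,-1)$. **Theorem (Concentration along the diagonals).** There exists a constant $c>0$ such that for every $\varepsilon>0$ $$\lim_{L\to\infty}\mathbf P_{\mathrm{unif},L}\Big(\exists\,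 i\in\{1,\dots,4\}:\ \sup_{t\in[0,1]}\big|\tilde\pi^L_t-c\,t\,\vec e_i\big|\le\varepsilon\Big)=1.$$ -/

import Mathlib

open Filter Topology ProbabilityTheory

namespace PrudentWalk

/-- A finite sequence `(π_0, …, π_L)` of points of `ℤ²`. -/
abbrev LatticePath (L : ℕ) : Type := Fin (L + 1) → ℤ × ℤ

/-- The four nearest-neighbour steps of `ℤ²`. -/
def unitSteps : Set (ℤ × ℤ) := {(1, 0), (-1, 0), (0, 1), (0, -1)}

/-- `π` is an `L`-step prudent path: it starts at the origin, makes nearest-neighbour steps, and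
never steps in the direction of a site already visited. (The case `n = 1` of the last field
gives self-avoidance.) -/
structure IsPrudent {L : ℕ} (π : LatticePath L) : Prop where
  start : π 0 = (0, 0)
  step : ∀ i : Fin L, π i.succ - π i.castSucc ∈ unitSteps
  prudent : ∀ i : Fin L, ∀ n : ℕ, 1 ≤ n → ∀ j : Fin (L + 1), j ≤ i.castSucc →
    π i.castSucc + n • (π i.succ - π i.castSucc) ≠ π j

/-- The set `Ω_L` of `L`-step prudent paths. -/
def prudentPaths (L : ℕ) : Set (LatticePath L) := {π | IsPrudent π}

/-- The uniform law on `Ω_L`, as a measure on the (discrete, countable) space of sequences of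
`L + 1` points of `ℤ²`. -/
noncomputable def uniformLaw (L : ℕ) : MeasureTheory.Measure (LatticePath L) :=
  uniformOn (prudentPaths L)

/-- The position of `π` after `k` steps, as a point of the Euclidean plane. For `k > L` the value
is that at time `L`; it only occurs with weight `0` in the interpolation below. -/
noncomputable def position {L : ℕ} (π : LatticePath L) (k : ℕ) : EuclideanSpace ℝ (Fin 2) :=
  let p := π ⟨min k L, Nat.lt_succ_of_le (min_le_right k L)⟩
  !₂[(p.1 : ℝ), (p.2 : ℝ)]

/-- The rescaled and linearly interpolated path
`L⁻¹ (π_⌊tL⌋ + (tL - ⌊tL⌋) (π_{⌊tL⌋+1} - π_⌊tL⌋))`, for `t ∈ [0,1]`. -/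
noncomputable def rescaledPath {L : ℕ} (π : LatticePath L) (t : ℝ) : EuclideanSpace ℝ (Fin 2) :=
  (1 / (L : ℝ)) •
    (position π ⌊t * L⌋₊ +
      (t * L - (⌊t * L⌋₊ : ℝ)) • (position π (⌊t * L⌋₊ + 1) - position π ⌊t * L⌋₊))

/-- The four diagonal directions `(1,1)`, `(-1,1)`, `(-1,-1)`, `(1,-1)`. -/
noncomputable def diagonal : Fin 4 → EuclideanSpace ℝ (Fin 2) :=
  ![!₂[1, 1], !₂[-1, 1], !₂[-1, -1], !₂[1, -1]]

end PrudentWalk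

/-!
A prudent path is described by a finite amount of data: its endpoint always lies on the boundary of
its bounding box, and which steps are allowed depends only on whether the last step enlarged the box
(`prudent_structure`). Along a side, the state of the walk is given by the distances `a` and `b` of
the endpoint to the two corners of the side and by the perpendicular extent `n` of the box. This
turns prudent paths into the paths of a transfer operator on explicit states.

Near a single corner of an infinite box the transfer operator has an explicit positive
eigenfunction, decaying like `z ^ a` with the distance `a` to the corner. The same is true when
the outward steps on the two axes carry weights `t`; parametrized by the eigenvalue `lam` and the
ratio of the two weights, everything is rational (`Tilt`). The unweighted operator has the critical
eigenvalue `lam ≈ 2.48`, larger than the growth rate `1 + √2` of a walk far from the corners. The sum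
of the eigenfunctions at both corners of a side, corrected by bounded factors depending on the size
of the box, is a supersolution (`Tilt.super_valU`, `Tilt.super_valM`) or, with other factors, a
subsolution (`Tilt.sub_valU`, `Tilt.sub_valM`) for all prudent paths. The latter gives at least
`const * lam ^ L` prudent paths. Adding to the former a small multiple of a function that grows
exponentially with the distance to the nearest corner increases the growth rate by an arbitrarily
small amount (`Tilt.exists_weight`) and makes the weight bounded below. Chebyshev's inequality then
bounds the number of paths with an atypical box or an endpoint far from all corners at time `k`
(`Tilt.exists_count_le`).

Differentiating the weights along two curves of tilts through the critical one shows that, up to an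
exponentially small proportion of the paths, width and height of the box at time `k` are both
`c * k + o(L)`, and the endpoint is at distance `o(L)` from a corner (`exists_concentration`). On
this event the path cannot change corners once the box is large, since it would have to move along
a whole side; the opposite sides are then frozen, and the path follows the corner, which moves along
a diagonal (`exists_sign`).
-/

namespace PrudentWalk

/-! ### Words of steps and the box of visited sites -/

/-- A lattice direction: the first component says whether it is vertical, the second whether it
points to the positive side of its axis. -/
abbrev Dir : Type := Bool × Bool

/-- The opposite direction. -/
def opp (d : Dir) : Dir := (d.1, !d.2)

/-- The positive direction of the axis perpendicular to that of `d`. -/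
def perp (d : Dir) : Dir := (!d.1, true)

/-- The unit vector of `ℤ²` pointing in direction `d`. -/
def vec : Dir → ℤ × ℤ
  | (false, true) => (1, 0)
  | (false, false) => (-1, 0)
  | (true, true) => (0, 1)
  | (true, false) => (0, -1)

/-- The coordinate of a lattice point along the oriented direction `d`. -/
def coord : Dir → ℤ × ℤ → ℤ
  | (false, true), v => v.1
  | (false, false), v => -v.1
  | (true, true), v => v.2
  | (true, false), v => -v.2

/-- The endpoint of the path from the origin whose steps are the letters of the word; the head of
the list is the last step. -/
def pos : List Dir → ℤ × ℤ
  | [] => (0, 0)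
  | d :: w => pos w + vec d

/-- The set of sites visited by the path coded by a word. -/
def visited : List Dir → Set (ℤ × ℤ)
  | [] => {(0, 0)}
  | d :: w => insert (pos (d :: w)) (visited w)

/-- The path coded by `w` may be continued prudently by a step in direction `d`. -/
def Allowed (w : List Dir) (d : Dir) : Prop :=
  ∀ n : ℕ, 1 ≤ n → pos w + n • vec d ∉ visited w

/-- The word codes a prudent path. -/
def Prudent : List Dir → Prop
  | [] => True
  | d :: w => Prudent w ∧ Allowed w d

/-- The distance from the endpoint of the path to the side of its bounding box with outer
normal `d`. -/
def gap : List Dir → Dir → ℕ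
  | [], _ => 0
  | e :: w, d => if d = e then gap w d - 1 else if d = opp e then gap w d + 1 else gap w d

/-- The outer normal of the side of the bounding box along which the path currently moves: the
direction of the last step that enlarged the box. -/
def normal : List Dir → Dir
  | [] => (false, true)
  | e :: w => if gap w e = 0 then e else normal w

lemma coord_add (d : Dir) (v v' : ℤ × ℤ) : coord d (v + v') = coord d v + coord d v' := by
  obtain ⟨_ | _, _ | _⟩ := d <;> simp [coord] <;> ring

lemma coord_nsmul (d : Dir) (n : ℕ) (v : ℤ × ℤ) : coord d (n • v) = n * coord d v := by
  obtain ⟨_ | _, _ | _⟩ := d <;> simp [coord]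

lemma coord_vec (d e : Dir) :
    coord d (vec e) = if d = e then 1 else if d = opp e then -1 else 0 := by
  obtain ⟨_ | _, _ | _⟩ := d <;> obtain ⟨_ | _, _ | _⟩ := e <;> simp [coord, vec, opp]

lemma coord_opp (d : Dir) (v : ℤ × ℤ) : coord (opp d) v = -coord d v := by
  obtain ⟨_ | _, _ | _⟩ := d <;> simp [coord, opp]

lemma opp_ne (d : Dir) : opp d ≠ d := by
  obtain ⟨_ | _, _ | _⟩ := d <;> simp [opp]

@[simp] lemma opp_opp (d : Dir) : opp (opp d) = d := by
  obtain ⟨_ | _, _ | _⟩ := d <;> simp [opp]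

/-- Two perpendicular coordinates determine a lattice point. -/
lemma eq_of_coord {d e : Dir} (h : d.1 ≠ e.1) {v v' : ℤ × ℤ} (hd : coord d v = coord d v')
    (he : coord e v = coord e v') : v = v' := by
  obtain ⟨_ | _, _ | _⟩ := d <;> obtain ⟨_ | _, _ | _⟩ := e <;> simp [coord] at * <;>
    exact Prod.ext (by assumption) (by assumption)

lemma coord_vec_perp {d e : Dir} (h : d.1 ≠ e.1) : coord d (vec e) = 0 := by
  rw [coord_vec, if_neg (by rintro rfl; exact h rfl), if_neg (by rintro rfl; exact h rfl)]

lemma coord_vec_self (d : Dir) : coord d (vec d) = 1 := by simp [coord_vec]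

lemma coord_pos_cons (d e : Dir) (w : List Dir) :
    coord d (pos (e :: w)) = coord d (pos w) + coord d (vec e) := coord_add _ _ _

lemma pos_mem_visited (w : List Dir) : pos w ∈ visited w := by
  cases w <;> simp [visited, pos]

lemma gap_cons_self (e : Dir) (w : List Dir) : gap (e :: w) e = gap w e - 1 := by simp [gap]

lemma gap_cons_opp (e : Dir) (w : List Dir) : gap (e :: w) (opp e) = gap w (opp e) + 1 := by
  simp [gap, opp_ne]

lemma gap_cons_perp {d e : Dir} (h : d.1 ≠ e.1) (w : List Dir) : gap (e :: w) d = gap w d := by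
  rw [gap, if_neg (by rintro rfl; exact h rfl), if_neg (by rintro rfl; exact h rfl)]

/-- `coord d (pos w) + gap w d` bounds the extent of the visited set in direction `d`. -/
lemma coord_le_of_mem_visited (d : Dir) :
    ∀ (w : List Dir), ∀ v ∈ visited w, coord d v ≤ coord d (pos w) + gap w d
  | [], v, hv => by
      rw [Set.mem_singleton_iff.1 hv]; simp [gap, pos]
  | e :: w, v, hv => by
      rcases hv with rfl | hv
      · simp
      · have := coord_le_of_mem_visited d w v hv
        rw [coord_pos_cons, coord_vec, gap]
        split_ifs <;> push_cast <;> omega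

/-- The path crosses every line between its endpoint and the side of the box with normal `d`. -/
lemma exists_mem_visited_coord_eq (d : Dir) :
    ∀ (w : List Dir) (c : ℤ), coord d (pos w) ≤ c → c ≤ coord d (pos w) + gap w d →
      ∃ v ∈ visited w, coord d v = c
  | [], c, h1, h2 => ⟨(0, 0), rfl, by simp [gap, pos] at *; omega⟩
  | e :: w, c, h1, h2 => by
      by_cases hc : c = coord d (pos (e :: w))
      · exact ⟨_, pos_mem_visited _, hc.symm⟩
      · obtain ⟨v, hv, hvc⟩ := exists_mem_visited_coord_eq d w c
          (by rw [coord_pos_cons, coord_vec] at *; split_ifs at * <;> omega)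
          (by
            rw [coord_pos_cons, coord_vec, gap] at *
            split_ifs at * <;> push_cast at * <;> omega)
        exact ⟨v, Or.inr hv, hvc⟩

/-! ### The local description of prudence -/

lemma allowed_straight {w : List Dir} {e : Dir} (h : Allowed w e) : Allowed (e :: w) e := by
  intro n hn hv
  have e1 : pos (e :: w) + n • vec e = pos w + (n + 1) • vec e := by
    rw [pos, add_smul, one_smul]; abel
  rcases hv with hv | hv
  · have := congrArg (coord e) hv
    rw [coord_add, coord_nsmul, coord_vec_self] at this
    omega
  · rw [e1] at hv
    exact h (n + 1) (by omega) hv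

lemma not_allowed_opp (w : List Dir) (e : Dir) : ¬ Allowed (e :: w) (opp e) := by
  intro h
  refine h 1 le_rfl (Or.inr ?_)
  have : vec e + vec (opp e) = 0 := by obtain ⟨_ | _, _ | _⟩ := e <;> simp [vec, opp]
  rw [one_smul, pos, add_assoc, this, add_zero]
  exact pos_mem_visited w

lemma allowed_of_gap_eq_zero {w : List Dir} {d : Dir} (h : gap w d = 0) : Allowed w d := by
  intro n hn hv
  have := coord_le_of_mem_visited d w _ hv
  rw [coord_add, coord_nsmul, coord_vec_self, h] at this
  push_cast at this
  omega

/-- After a step that enlarges the box, the new row contains no other visited site, so that both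
directions along it are free. -/
lemma allowed_perp_of_outward {w : List Dir} {e d : Dir} (h : gap w e = 0) (hd : e.1 ≠ d.1) :
    Allowed (e :: w) d := by
  intro n hn hv
  rcases hv with hv | hv
  · have := congrArg (coord d) hv
    rw [coord_add, coord_nsmul, coord_vec_self] at this
    omega
  · have := coord_le_of_mem_visited e w _ hv
    rw [coord_add, coord_nsmul, coord_vec_perp hd, coord_pos_cons, coord_vec_self, h] at this
    push_cast at this
    omega

/-- After a step along the side with normal `ν` that does not enlarge the box, the way inwards is
blocked, because the path has crossed this line before. -/
lemma not_allowed_opp_normal {w : List Dir} {e ν : Dir} (ha : Allowed w e) (h : gap w e ≠ 0)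
    (hν : gap w ν = 0) (hd : ν.1 ≠ e.1) : ¬ Allowed (e :: w) (opp ν) := by
  intro hall
  obtain ⟨v, hv, hvc⟩ := exists_mem_visited_coord_eq e w (coord e (pos w) + 1) (by omega) (by omega)
  have h1 := coord_le_of_mem_visited ν w v hv
  rw [hν] at h1
  push_cast at h1
  have hne : coord ν v ≠ coord ν (pos w) := by
    intro heq
    apply ha 1 le_rfl
    have : pos w + 1 • vec e = v := by
      apply eq_of_coord hd
      · rw [coord_add, one_smul, coord_vec_perp hd, heq, add_zero]
      · rw [coord_add, one_smul, coord_vec_self, hvc]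
    rwa [this]
  obtain ⟨n, hn⟩ := Int.eq_ofNat_of_zero_le (show 0 ≤ coord ν (pos w) - coord ν v by omega)
  have hvis : pos (e :: w) + n • vec (opp ν) = v := by
    apply eq_of_coord hd
    · rw [coord_add, coord_nsmul, coord_pos_cons, coord_vec_perp hd, coord_vec,
        if_neg (opp_ne ν).symm, if_pos (opp_opp ν).symm]
      omega
    · rw [coord_add, coord_nsmul, coord_pos_cons, coord_vec_self, hvc, coord_vec_perp]
      · omega
      · exact fun h => hd h.symm
  refine hall n (by omega) (Or.inr ?_)
  rwa [hvis]

lemma eq_or_eq_opp {d e : Dir} (h : d.1 = e.1) : d = e ∨ d = opp e := by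
  obtain ⟨_ | _, _ | _⟩ := d <;> obtain ⟨_ | _, _ | _⟩ := e <;> simp [opp] at *

/-- The local description of prudence. The endpoint of a prudent path lies on the side of the box
whose normal is `normal`; after an outward step all directions but the backward one are allowed,
and after a step along a side exactly the forward and the outer normal direction are. -/
lemma prudent_structure : ∀ (w : List Dir) (e : Dir), Prudent (e :: w) →
    gap (e :: w) (normal (e :: w)) = 0 ∧ (gap w e ≠ 0 → (normal w).1 ≠ e.1) ∧
    ∀ d, Allowed (e :: w) d ↔ if gap w e = 0 then d ≠ opp e else d = e ∨ d = normal w := by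
  have key : ∀ (w : List Dir) (e : Dir), Prudent (e :: w) →
      (gap w e ≠ 0 → (normal w).1 ≠ e.1 ∧ gap w (normal w) = 0) →
      gap (e :: w) (normal (e :: w)) = 0 ∧ (gap w e ≠ 0 → (normal w).1 ≠ e.1) ∧
      ∀ d, Allowed (e :: w) d ↔ if gap w e = 0 then d ≠ opp e else d = e ∨ d = normal w := by
    intro w e hp h
    by_cases hg : gap w e = 0
    · refine ⟨by simp [normal, hg, gap_cons_self], fun h' => absurd hg h', fun d => ?_⟩
      rw [if_pos hg]
      constructor
      · rintro hd rfl
        exact not_allowed_opp w e hd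
      · intro hd
        by_cases hde : d.1 = e.1
        · rcases eq_or_eq_opp hde with rfl | h'
          · exact allowed_straight hp.2
          · exact absurd h' hd
        · exact allowed_perp_of_outward hg (Ne.symm hde)
    · obtain ⟨hn1, hn2⟩ := h hg
      have hg0 : gap (e :: w) (normal w) = 0 := by rw [gap_cons_perp hn1, hn2]
      refine ⟨by rw [normal, if_neg hg, hg0], fun _ => hn1, fun d => ?_⟩
      rw [if_neg hg]
      constructor
      · intro hd
        by_cases hde : d.1 = e.1
        · rcases eq_or_eq_opp hde with rfl | rfl
          · exact Or.inl rfl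
          · exact absurd hd (not_allowed_opp w e)
        · have : d.1 = (normal w).1 := by
            revert hde hn1
            cases d.1 <;> cases e.1 <;> cases (normal w).1 <;> simp
          rcases eq_or_eq_opp this with h' | rfl
          · exact Or.inr h'
          · exact absurd hd (not_allowed_opp_normal hp.2 hg hn2 hn1)
      · rintro (rfl | rfl)
        · exact allowed_straight hp.2
        · exact allowed_of_gap_eq_zero hg0
  intro w
  induction w with
  | nil => exact fun e hp => key [] e hp (fun h => absurd rfl h)
  | cons e' w ih =>
    intro e hp
    refine key _ e hp fun hg => ?_
    obtain ⟨h1, h2, h3⟩ := ih e' hp.1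
    refine ⟨?_, h1⟩
    have ha := (h3 e).1 hp.2
    have hne : e ≠ normal (e' :: w) := by rintro rfl; exact hg h1
    by_cases hg' : gap w e' = 0
    · rw [if_pos hg'] at ha
      rw [normal, if_pos hg'] at hne ⊢
      intro h
      rcases eq_or_eq_opp h.symm with h | h
      · exact hne h
      · exact ha h
    · rw [if_neg hg'] at ha
      rw [normal, if_neg hg'] at hne ⊢
      rcases ha with rfl | rfl
      · exact h2 hg'
      · exact absurd rfl hne

/-! ### Finite sets of prudent words -/

open Classical in
/-- The prudent words with `k` letters. -/
noncomputable def words : ℕ → Finset (List Dir)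
  | 0 => {[]}
  | k + 1 => (words k).biUnion fun w => (Finset.univ.filter (Allowed w)).image (· :: w)

lemma mem_words : ∀ {k : ℕ} {w : List Dir}, w ∈ words k ↔ w.length = k ∧ Prudent w
  | 0, w => by
      simp only [words, Finset.mem_singleton, List.length_eq_zero_iff]
      constructor
      · rintro rfl; exact ⟨rfl, trivial⟩
      · exact fun h => h.1
  | k + 1, [] => by simp [words]
  | k + 1, d :: w => by
      simp only [words, Finset.mem_biUnion, mem_words (k := k), Finset.mem_image,
        Finset.mem_filter, Finset.mem_univ, true_and, List.cons.injEq, List.length_cons,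
        add_left_inj, Prudent]
      constructor
      · rintro ⟨w', ⟨h1, h2⟩, d', h3, rfl, rfl⟩
        exact ⟨h1, h2, h3⟩
      · rintro ⟨h1, h2, h3⟩
        exact ⟨w, ⟨h1, h2⟩, d, h3, rfl, rfl⟩

open Classical in
lemma sum_words_succ (k : ℕ) (f : List Dir → ℝ) :
    ∑ w ∈ words (k + 1), f w =
      ∑ w ∈ words k, ∑ d ∈ Finset.univ.filter (Allowed w), f (d :: w) := by
  rw [words, Finset.sum_biUnion]
  · refine Finset.sum_congr rfl fun w _ => ?_
    rw [Finset.sum_image]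
    intro a _ b _ h
    exact (List.cons.inj h).1
  · intro w _ w' _ hne
    rw [Function.onFun, Finset.disjoint_left]
    rintro x hx hx'
    simp only [Finset.mem_image] at hx hx'
    obtain ⟨d, _, rfl⟩ := hx
    obtain ⟨d', _, h⟩ := hx'
    exact hne (List.cons.inj h).2.symm

/-! ### The eigenfunction at a corner -/

/-- The parameters of the explicit eigenfunction of a walk at the corner of an infinite box:
`lam` is its eigenvalue, and `mu o` is the weight of an outward step times the value of the
state it leads to, `o` being the axis parallel to the normal of the side. The weights of the
outward steps are functions of these parameters, which makes everything rational. -/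
structure Tilt where
  lam : ℝ
  mu : Bool → ℝ
  lam_gt : 1 < lam
  mu_pos : ∀ o, 0 < mu o
  z_lt_one' : ∀ o, (mu o + mu (!o)) / (lam * mu (!o)) < 1

namespace Tilt

variable (T : Tilt)

/-- The rate of decay of the eigenfunction along a side, away from the corner. -/
noncomputable def z (o : Bool) : ℝ := (T.mu o + T.mu (!o)) / (T.lam * T.mu (!o))

/-- The value of a state that moves away from the corner. -/
noncomputable def l (o : Bool) : ℝ := T.mu o / (T.lam - T.z o)

/-- The value of a state whose last step was outward. -/
noncomputable def u (o : Bool) : ℝ := (T.mu o + T.mu (!o) + T.z o * T.l o) / T.lam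

/-- The weight of an outward step along the axis `o`. -/
noncomputable def t (o : Bool) : ℝ := T.mu o / T.u o

lemma lam_pos : 0 < T.lam := one_pos.trans T.lam_gt

lemma z_pos (o : Bool) : 0 < T.z o :=
  div_pos (add_pos (T.mu_pos _) (T.mu_pos _)) (mul_pos T.lam_pos (T.mu_pos _))

lemma z_lt_one (o : Bool) : T.z o < 1 := T.z_lt_one' o

lemma sub_z_pos (o : Bool) : 0 < T.lam - T.z o := by linarith [T.lam_gt, T.z_lt_one o]

lemma l_pos (o : Bool) : 0 < T.l o := div_pos (T.mu_pos o) (T.sub_z_pos o)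

lemma u_pos (o : Bool) : 0 < T.u o := by
  have := T.mu_pos o
  have := T.mu_pos (!o)
  have := mul_pos (T.z_pos o) (T.l_pos o)
  exact div_pos (by linarith) T.lam_pos

lemma t_pos (o : Bool) : 0 < T.t o := div_pos (T.mu_pos o) (T.u_pos o)

lemma t_mul_u (o : Bool) : T.t o * T.u o = T.mu o := div_mul_cancel₀ _ (T.u_pos o).ne'

lemma lam_mul_z_mul (o : Bool) : T.lam * (T.z o * T.mu (!o)) = T.mu o + T.mu (!o) := by
  have := (T.mu_pos (!o)).ne'
  have := T.lam_pos.ne'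
  rw [z]; field_simp

lemma lam_mul_l (o : Bool) : T.lam * T.l o = T.mu o + T.z o * T.l o := by
  have := (T.sub_z_pos o).ne'
  have h : (T.lam - T.z o) * T.l o = T.mu o := mul_div_cancel₀ _ this
  linarith

lemma lam_mul_u (o : Bool) : T.lam * T.u o = T.mu o + T.mu (!o) + T.z o * T.l o :=
  mul_div_cancel₀ _ T.lam_pos.ne'

variable (K : ℕ → ℕ → ℝ)

/-- The value of a state on a side with normal axis `o` after an outward step: `a` and `b` are the
distances to the two ends of the side and `n` is the perpendicular extent of the box. The factor
`K` corrects for the finite size of the box. -/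
noncomputable def valU (o : Bool) (a b n : ℕ) : ℝ :=
  K (a + b) n * (T.u o * (T.z o ^ a + T.z o ^ b))

/-- The value of a state moving along a side, with `a` sites ahead and `b` behind. -/
noncomputable def valM (o : Bool) (a b n : ℕ) : ℝ :=
  K (a + b) n * (T.z o * T.mu (!o) * T.z o ^ a + T.l o * T.z o ^ b)

/-- The weighted value of the state reached by a step along the side: such a step leads past the
corner if there is no site ahead, and is then outward for the adjacent side. -/
noncomputable def valStep (o : Bool) (a b n : ℕ) : ℝ :=
  if a = 0 then T.t (!o) * T.valU K (!o) 0 n (b + 1) else T.valM K o (a - 1) (b + 1) n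

/-- The value of a step along the side on an infinite side without corner effects. -/
noncomputable def idealStep (o : Bool) (a b n : ℕ) : ℝ :=
  K (a + b) n * (T.mu (!o) * T.z o ^ a + T.l o * T.z o ^ (b + 1))

lemma valStep_succ (o : Bool) (a b n : ℕ) :
    T.valStep K o (a + 1) b n = T.idealStep K o (a + 1) b n := by
  simp only [valStep, valM, idealStep, Nat.add_sub_cancel, if_neg (Nat.succ_ne_zero a)]
  rw [show a + (b + 1) = a + 1 + b by ring]
  ring

lemma valStep_zero (o : Bool) (b n : ℕ) :
    T.valStep K o 0 b n = K n (b + 1) * (T.mu (!o) * (1 + T.z (!o) ^ n)) := by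
  rw [valStep, if_pos rfl, valU, ← T.t_mul_u (!o), zero_add, pow_zero]
  ring

/-- The eigenvalue equation after an outward step. -/
lemma ideal_valU (o : Bool) (a b n : ℕ) :
    K (a + b) n * (T.t o * (T.u o * (T.z o ^ a + T.z o ^ b))) + T.idealStep K o a b n +
      T.idealStep K o b a n = T.lam * T.valU K o a b n := by
  simp only [idealStep, valU]
  rw [add_comm b a, pow_succ, pow_succ]
  linear_combination K (a + b) n * (T.z o ^ a + T.z o ^ b) * (T.t_mul_u o - T.lam_mul_u o)

/-- The eigenvalue equation for a state moving along a side. -/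
lemma ideal_valM (o : Bool) (a b n : ℕ) :
    K (a + b) n * (T.t o * (T.u o * (T.z o ^ a + T.z o ^ b))) + T.idealStep K o a b n =
      T.lam * T.valM K o a b n := by
  simp only [idealStep, valM]
  rw [pow_succ]
  linear_combination K (a + b) n * ((T.z o ^ a + T.z o ^ b) * T.t_mul_u o -
    T.z o ^ a * T.lam_mul_z_mul o - T.z o ^ b * T.lam_mul_l o)

section Super

variable {K} (hK : ∀ ℓ n, 0 ≤ K ℓ n) (h1 : ∀ ℓ n, K ℓ (n + 1) ≤ K ℓ n)
  (h2 : ∀ o ℓ n, K n (ℓ + 1) * (1 + T.z o ^ n) ≤ K ℓ n)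

include hK h2 in
lemma valStep_le (o : Bool) (a b n : ℕ) : T.valStep K o a b n ≤ T.idealStep K o a b n := by
  cases a with
  | succ a => exact (T.valStep_succ K o a b n).le
  | zero =>
    rw [valStep_zero, idealStep, zero_add, pow_zero, mul_one]
    have := mul_le_mul_of_nonneg_left (h2 (!o) b n) (T.mu_pos (!o)).le
    have := mul_nonneg (hK b n) (mul_pos (T.l_pos o) (pow_pos (T.z_pos o) (b + 1))).le
    linarith

include h1 in
lemma valU_outward_le (o : Bool) (a b n : ℕ) : T.t o * T.valU K o a b (n + 1) ≤
    K (a + b) n * (T.t o * (T.u o * (T.z o ^ a + T.z o ^ b))) := by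
  have hz := T.z_pos o
  have hu := T.u_pos o
  have ht := T.t_pos o
  have := mul_le_mul_of_nonneg_right (h1 (a + b) n)
    (show 0 ≤ T.t o * (T.u o * (T.z o ^ a + T.z o ^ b)) by positivity)
  rw [valU]; linarith

include hK h1 h2 in
lemma super_valU (o : Bool) (a b n : ℕ) :
    T.t o * T.valU K o a b (n + 1) + T.valStep K o a b n + T.valStep K o b a n ≤
      T.lam * T.valU K o a b n := by
  rw [← ideal_valU]
  exact add_le_add (add_le_add (T.valU_outward_le h1 o a b n) (T.valStep_le hK h2 o a b n))
    (T.valStep_le hK h2 o b a n)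

include hK h1 h2 in
lemma super_valM (o : Bool) (a b n : ℕ) :
    T.t o * T.valU K o a b (n + 1) + T.valStep K o a b n ≤ T.lam * T.valM K o a b n := by
  rw [← ideal_valM]
  exact add_le_add (T.valU_outward_le h1 o a b n) (T.valStep_le hK h2 o a b n)

end Super

section Sub

variable {K} (h1 : ∀ ℓ n, K ℓ n ≤ K ℓ (n + 1))
  (h2 : ∀ o ℓ n, K ℓ n * (T.mu (!o) + T.l o * T.z o ^ (ℓ + 1)) ≤ K n (ℓ + 1) * T.mu (!o))
  (hK : ∀ ℓ n, 0 ≤ K ℓ n)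

include h2 hK in
lemma le_valStep (o : Bool) (a b n : ℕ) : T.idealStep K o a b n ≤ T.valStep K o a b n := by
  cases a with
  | succ a => exact (T.valStep_succ K o a b n).ge
  | zero =>
    rw [valStep_zero, idealStep, zero_add, pow_zero, mul_one]
    have := h2 o b n
    have := mul_nonneg (hK n (b + 1)) (mul_pos (T.mu_pos (!o)) (pow_pos (T.z_pos (!o)) n)).le
    linarith

include h1 in
lemma le_valU_outward (o : Bool) (a b n : ℕ) :
    K (a + b) n * (T.t o * (T.u o * (T.z o ^ a + T.z o ^ b))) ≤
      T.t o * T.valU K o a b (n + 1) := by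
  have hz := T.z_pos o
  have hu := T.u_pos o
  have ht := T.t_pos o
  have := mul_le_mul_of_nonneg_right (h1 (a + b) n)
    (show 0 ≤ T.t o * (T.u o * (T.z o ^ a + T.z o ^ b)) by positivity)
  rw [valU]; linarith

include h1 h2 hK in
lemma sub_valU (o : Bool) (a b n : ℕ) : T.lam * T.valU K o a b n ≤
    T.t o * T.valU K o a b (n + 1) + T.valStep K o a b n + T.valStep K o b a n := by
  rw [← ideal_valU]
  exact add_le_add (add_le_add (T.le_valU_outward h1 o a b n) (T.le_valStep h2 hK o a b n))
    (T.le_valStep h2 hK o b a n)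

include h1 h2 hK in
lemma sub_valM (o : Bool) (a b n : ℕ) : T.lam * T.valM K o a b n ≤
    T.t o * T.valU K o a b (n + 1) + T.valStep K o a b n := by
  rw [← ideal_valM]
  exact add_le_add (T.le_valU_outward h1 o a b n) (T.le_valStep h2 hK o a b n)

end Sub

end Tilt

/-! ### Summing functions of the local state over the continuations of a path -/

/-- The value of the state reached by a step along a side with normal axis `o`, where `a` and `b`
are the distances to the ends of the side ahead and behind, `n` is the perpendicular extent of the
box, and `FU`, `FM` are the values of the states after outward and other steps. -/
def stepVal (FU FM : Bool → ℕ → ℕ → ℕ → ℝ) (o : Bool) (a b n : ℕ) : ℝ :=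
  if a = 0 then FU (!o) 0 n (b + 1) else FM o (a - 1) (b + 1) n

/-- The function of prudent words that depends on the local state only, with values `FU` after
outward steps and `FM` after other steps; the value at the empty word is `0` by convention. -/
def stateVal (FU FM : Bool → ℕ → ℕ → ℕ → ℝ) : List Dir → ℝ
  | [] => 0
  | e :: w =>
    if gap w e = 0 then
      FU e.1 (gap (e :: w) (perp e)) (gap (e :: w) (opp (perp e))) (gap (e :: w) (opp e))
    else
      FM (normal w).1 (gap (e :: w) e) (gap (e :: w) (opp e)) (gap (e :: w) (opp (normal w)))

lemma opp_perp_fst_ne (d : Dir) : (opp (perp d)).1 ≠ d.1 := by simp [opp, perp]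

lemma perp_fst_ne (d : Dir) : (perp d).1 ≠ d.1 := by simp [perp]

lemma eq_perp_or {d e : Dir} (h : d.1 ≠ e.1) : d = perp e ∨ d = opp (perp e) := by
  obtain ⟨_ | _, _ | _⟩ := d <;> obtain ⟨_ | _, _ | _⟩ := e <;> simp [opp, perp] at *

section

variable {FU FM : Bool → ℕ → ℕ → ℕ → ℝ} (hsymm : ∀ o a b n, FU o a b n = FU o b a n)

include hsymm in
lemma symm_perp {d e : Dir} (h : d.1 ≠ e.1) (w : List Dir) (o : Bool) (n : ℕ) :
    FU o (gap w (perp e)) (gap w (opp (perp e))) n = FU o (gap w d) (gap w (opp d)) n := by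
  rcases eq_perp_or h with rfl | rfl
  · rfl
  · rw [opp_opp]; exact hsymm _ _ _ _

include hsymm in
lemma stateVal_cons_along {w : List Dir} {d : Dir} (h0 : gap w (normal w) = 0)
    (hd : d.1 ≠ (normal w).1) :
    stateVal FU FM (d :: w) =
      stepVal FU FM (normal w).1 (gap w d) (gap w (opp d)) (gap w (opp (normal w))) := by
  have hd' : (opp (normal w)).1 ≠ d.1 := fun h => hd h.symm
  rw [stateVal, stepVal]
  split_ifs with h
  · rw [symm_perp hsymm (Ne.symm hd), gap_cons_perp (Ne.symm hd), gap_cons_perp hd', h0,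
      gap_cons_opp]
    congr 1
    revert hd
    cases d.1 <;> cases (normal w).1 <;> simp
  · rw [gap_cons_self, gap_cons_opp, gap_cons_perp hd']

lemma stateVal_cons_normal {w : List Dir} {ν : Dir} (h0 : gap w ν = 0) :
    stateVal FU FM (ν :: w) =
      FU ν.1 (gap w (perp ν)) (gap w (opp (perp ν))) (gap w (opp ν) + 1) := by
  rw [stateVal, if_pos h0, gap_cons_perp (perp_fst_ne ν), gap_cons_perp (opp_perp_fst_ne ν),
    gap_cons_opp]

open Classical in
include hsymm in
/-- An inequality between the values of all states and those of their successors gives the same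
inequality for prudent words and their one-step continuations. -/
lemma sum_allowed_le {c : ℝ}
    (hU : ∀ o a b n, FU o a b (n + 1) + stepVal FU FM o a b n + stepVal FU FM o b a n ≤
      c * FU o a b n)
    (hM : ∀ o a b n, FU o a b (n + 1) + stepVal FU FM o a b n ≤ c * FM o a b n)
    {w : List Dir} (hw : Prudent w) (hne : w ≠ []) :
    ∑ d ∈ Finset.univ.filter (Allowed w), stateVal FU FM (d :: w) ≤ c * stateVal FU FM w := by
  cases w with
  | nil => exact absurd rfl hne
  | cons e w =>
    obtain ⟨h1, h2, h3⟩ := prudent_structure w e hw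
    by_cases hg : gap w e = 0
    · have hf : Finset.univ.filter (Allowed (e :: w)) = {e, perp e, opp (perp e)} := by
        ext d
        simp only [Finset.mem_filter, Finset.mem_univ, true_and, h3 d, if_pos hg,
          Finset.mem_insert, Finset.mem_singleton]
        obtain ⟨_ | _, _ | _⟩ := d <;> obtain ⟨_ | _, _ | _⟩ := e <;> simp [opp, perp]
      have hn : normal (e :: w) = e := by rw [normal, if_pos hg]
      rw [hn] at h1
      have e1 : e ∉ ({perp e, opp (perp e)} : Finset Dir) := by
        obtain ⟨_ | _, _ | _⟩ := e <;> simp [opp, perp]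
      have e2 : perp e ∉ ({opp (perp e)} : Finset Dir) := by
        obtain ⟨_ | _, _ | _⟩ := e <;> simp [opp, perp]
      rw [hf, Finset.sum_insert e1, Finset.sum_insert e2, Finset.sum_singleton,
        stateVal_cons_normal h1, stateVal_cons_along hsymm (by rwa [hn]) (by
          rw [hn]; exact perp_fst_ne e), stateVal_cons_along hsymm (by rwa [hn]) (by
          rw [hn]; exact opp_perp_fst_ne e), hn, opp_opp, stateVal, if_pos hg, ← add_assoc]
      exact hU _ _ _ _
    · have hn : normal (e :: w) = normal w := by rw [normal, if_neg hg]
      have hp := h2 hg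
      rw [hn] at h1
      have hf : Finset.univ.filter (Allowed (e :: w)) = {normal w, e} := by
        ext d
        simp only [Finset.mem_filter, Finset.mem_univ, true_and, h3 d, if_neg hg,
          Finset.mem_insert, Finset.mem_singleton, or_comm]
      have e1 : normal w ∉ ({e} : Finset Dir) := by
        rw [Finset.mem_singleton]; rintro h; exact hp (by rw [h])
      rw [hf, Finset.sum_insert e1, Finset.sum_singleton, stateVal_cons_normal h1,
        stateVal_cons_along hsymm (by rwa [hn]) (by rw [hn]; exact Ne.symm hp), hn,
        symm_perp hsymm (Ne.symm hp), stateVal, if_neg hg]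
      exact hM _ _ _ _

open Classical in
include hsymm in
lemma le_sum_allowed {c : ℝ}
    (hU : ∀ o a b n, c * FU o a b n ≤
      FU o a b (n + 1) + stepVal FU FM o a b n + stepVal FU FM o b a n)
    (hM : ∀ o a b n, c * FM o a b n ≤ FU o a b (n + 1) + stepVal FU FM o a b n)
    {w : List Dir} (hw : Prudent w) (hne : w ≠ []) :
    c * stateVal FU FM w ≤ ∑ d ∈ Finset.univ.filter (Allowed w), stateVal FU FM (d :: w) := by
  have hstep : ∀ o a b n, stepVal (fun o a b n => -FU o a b n) (fun o a b n => -FM o a b n) o a b n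
      = -stepVal FU FM o a b n := by
    intro o a b n; simp only [stepVal]; split_ifs <;> rfl
  have hstate : ∀ w, stateVal (fun o a b n => -FU o a b n) (fun o a b n => -FM o a b n) w
      = -stateVal FU FM w := by
    intro w
    cases w with
    | nil => simp [stateVal]
    | cons e w => simp only [stateVal]; split_ifs <;> rfl
  have := sum_allowed_le (FU := fun o a b n => -FU o a b n) (FM := fun o a b n => -FM o a b n)
    (fun o a b n => by rw [hsymm]) (c := c)
    (fun o a b n => by rw [hstep, hstep]; linarith [hU o a b n])
    (fun o a b n => by rw [hstep]; linarith [hM o a b n]) hw hne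
  simp only [hstate, Finset.sum_neg_distrib] at this
  linarith

end

/-! ### Weights of finite boxes and states far from the corners -/

/-- The correction for a finite box that turns the sum of the eigenfunctions at two corners into
a supersolution: it decreases, by the right amount, each time a corner is passed. -/
noncomputable def upperFactor (ζ : ℝ) (ℓ n : ℕ) : ℝ := Real.exp ((ζ ^ n + ζ ^ (ℓ + 1)) / (1 - ζ))

lemma upperFactor_outward {ζ : ℝ} (h0 : 0 < ζ) (h1 : ζ < 1) (ℓ n : ℕ) :
    upperFactor ζ ℓ (n + 1) ≤ upperFactor ζ ℓ n := by
  have h1' : 0 < 1 - ζ := by linarith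
  have : ζ ^ (n + 1) ≤ ζ ^ n := pow_le_pow_of_le_one h0.le h1.le n.le_succ
  exact Real.exp_le_exp.2 (div_le_div_of_nonneg_right (by linarith) h1'.le)

lemma upperFactor_corner {ζ x : ℝ} (hx : 0 ≤ x) (hxζ : x ≤ ζ) (h1 : ζ < 1) (ℓ n : ℕ) :
    upperFactor ζ n (ℓ + 1) * (1 + x ^ n) ≤ upperFactor ζ ℓ n := by
  have h1' : 1 - ζ ≠ 0 := by linarith
  have hx : 1 + x ^ n ≤ Real.exp (ζ ^ n) :=
    (by linarith [pow_le_pow_left₀ hx hxζ n] : 1 + x ^ n ≤ ζ ^ n + 1).trans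
      (Real.add_one_le_exp _)
  refine (mul_le_mul_of_nonneg_left hx (Real.exp_pos _).le).trans (le_of_eq ?_)
  simp only [upperFactor]
  rw [← Real.exp_add]
  congr 1
  field_simp
  ring

lemma one_le_upperFactor {ζ : ℝ} (h0 : 0 < ζ) (h1 : ζ < 1) (ℓ n : ℕ) : 1 ≤ upperFactor ζ ℓ n := by
  have h1' : 0 < 1 - ζ := by linarith
  exact Real.one_le_exp (by positivity)

lemma upperFactor_le {ζ : ℝ} (h0 : 0 < ζ) (h1 : ζ < 1) (ℓ n : ℕ) :
    upperFactor ζ ℓ n ≤ Real.exp (2 / (1 - ζ)) := by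
  have h1' : 0 < 1 - ζ := by linarith
  have a1 : ζ ^ n ≤ 1 := pow_le_one₀ h0.le h1.le
  have a2 : ζ ^ (ℓ + 1) ≤ 1 := pow_le_one₀ h0.le h1.le
  exact Real.exp_le_exp.2 (div_le_div_of_nonneg_right (by linarith) h1'.le)

namespace Tilt

variable (T : Tilt)

/-- A common bound below `1` for the two rates of decay. -/
noncomputable def ζ : ℝ := max (T.z true) (T.z false)

lemma z_le_ζ (o : Bool) : T.z o ≤ T.ζ := by
  cases o
  · exact le_max_right _ _
  · exact le_max_left _ _

lemma ζ_lt_one : T.ζ < 1 := max_lt (T.z_lt_one _) (T.z_lt_one _)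

lemma ζ_pos : 0 < T.ζ := (T.z_pos true).trans_le (T.z_le_ζ _)

/-- The value of the states after an outward step in the weight that controls all prudent paths.
The second summand, exponentially growing in the distance to the nearest corner, is present with a
small factor `ε`; it makes the weight bounded below and costs a negligible increase of the
growth rate. Outward steps of the path are weighted by `t`. -/
noncomputable def weightU (ε y : ℝ) (o : Bool) (a b n : ℕ) : ℝ :=
  T.t o ^ n * T.t (!o) ^ (a + b) *
    (T.valU (upperFactor T.ζ) o a b n + ε * (71 / 50 * y ^ min a b))

/-- The value of the states moving along a side in the weight that controls all prudent paths. -/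
noncomputable def weightM (ε y : ℝ) (o : Bool) (a b n : ℕ) : ℝ :=
  T.t o ^ n * T.t (!o) ^ (a + b) * (T.valM (upperFactor T.ζ) o a b n + ε * y ^ min a b)

lemma weightU_symm (ε y : ℝ) (o : Bool) (a b n : ℕ) :
    T.weightU ε y o a b n = T.weightU ε y o b a n := by
  simp only [weightU, valU, add_comm b a, min_comm b a, add_comm (T.z o ^ b)]

lemma stepVal_weight_le {ε y : ℝ} (hε : 0 ≤ ε) (hy : 1 ≤ y)
    (ht : ∀ o, T.t o ≤ 101 / 100) (o : Bool) (a b n : ℕ) :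
    stepVal (T.weightU ε y) (T.weightM ε y) o a b n ≤ T.t o ^ n * T.t (!o) ^ (a + b) *
      (T.valStep (upperFactor T.ζ) o a b n + ε * (y * y ^ min a b + if a = 0 then 2 else 0)) := by
  have h1 := T.t_pos o
  have h2 := T.t_pos (!o)
  rw [stepVal, valStep]
  split_ifs with ha
  · subst ha
    have : T.weightU ε y (!o) 0 n (b + 1) = T.t o ^ n * T.t (!o) ^ (0 + b) *
        (T.t (!o) * T.valU (upperFactor T.ζ) (!o) 0 n (b + 1) + ε * (T.t (!o) * (71 / 50))) := by
      simp only [weightU, Bool.not_not, zero_add, Nat.zero_min, pow_zero]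
      ring
    rw [this, Nat.zero_min, pow_zero]
    gcongr
    linarith [ht (!o)]
  · have e1 : a - 1 + (b + 1) = a + b := by omega
    rw [weightM, e1, add_zero]
    gcongr
    rw [← pow_succ']
    exact pow_le_pow_right₀ hy (by omega)

/-- The one-step inequality for the weight: the growth rate exceeds `lam` by as little as desired
if `ε` is small. -/
lemma exists_weight {y δ : ℝ} (hy : 1 ≤ y) (hy' : y ≤ 101 / 100) (hδ : 0 < δ)
    (ht : ∀ o, T.t o ≤ 101 / 100) (hlam : 49 / 20 ≤ T.lam) : ∃ ε > 0,
      (∀ o a b n, T.weightU ε y o a b (n + 1) +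
        stepVal (T.weightU ε y) (T.weightM ε y) o a b n +
        stepVal (T.weightU ε y) (T.weightM ε y) o b a n ≤ (T.lam + δ) * T.weightU ε y o a b n) ∧
      (∀ o a b n, T.weightU ε y o a b (n + 1) +
        stepVal (T.weightU ε y) (T.weightM ε y) o a b n ≤
          (T.lam + δ) * T.weightM ε y o a b n) := by
  have hζ0 := T.ζ_pos
  have hζ1 := T.ζ_lt_one
  obtain ⟨v, hv, hvU, hvM⟩ : ∃ v > 0, (∀ o, v ≤ T.u o) ∧ ∀ o, v ≤ T.z o * T.mu (!o) := by
    refine ⟨min (min (T.u true) (T.u false)) (min (T.z true * T.mu false) (T.z false * T.mu true)),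
      ?_, ?_, ?_⟩
    · have h1 := T.u_pos; have h2 := T.z_pos; have h3 := T.mu_pos
      exact lt_min (lt_min (h1 _) (h1 _)) (lt_min (mul_pos (h2 _) (h3 _)) (mul_pos (h2 _) (h3 _)))
    · rintro (_ | _) <;> simp
    · rintro (_ | _) <;> simp
  have hK : ∀ ℓ n, 0 ≤ upperFactor T.ζ ℓ n := fun ℓ n => (Real.exp_pos _).le
  have hK1 := one_le_upperFactor hζ0 hζ1
  have hK2 := upperFactor_outward hζ0 hζ1
  have hK3 : ∀ o ℓ n, upperFactor T.ζ n (ℓ + 1) * (1 + T.z o ^ n) ≤ upperFactor T.ζ ℓ n :=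
    fun o ℓ n => upperFactor_corner (T.z_pos o).le (T.z_le_ζ o) hζ1 ℓ n
  -- At a corner `a = 0` the value of the eigenfunction is at least `v`.
  have corner : ∀ o a, v * (if a = 0 then 1 else 0) ≤ T.u o * T.z o ^ a := by
    intro o a
    split_ifs with h
    · rw [h, pow_zero]; linarith [hvU o]
    · have := T.u_pos o; have := T.z_pos o; rw [mul_zero]; positivity
  have cornerU : ∀ o a b n, v * ((if a = 0 then 1 else 0) + if b = 0 then 1 else 0) ≤
      T.valU (upperFactor T.ζ) o a b n := by
    intro o a b n
    have := corner o a
    have := corner o b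
    have h := T.u_pos o; have := T.z_pos o
    have h2 := le_mul_of_one_le_left
      (show 0 ≤ T.u o * (T.z o ^ a + T.z o ^ b) by positivity) (hK1 (a + b) n)
    rw [valU]
    linarith
  have cornerM : ∀ o a b n, v * (if a = 0 then 1 else 0) ≤
      T.valM (upperFactor T.ζ) o a b n := by
    intro o a b n
    have h := T.l_pos o; have h3 := T.z_pos o; have h4 := T.mu_pos (!o)
    have h2 := le_mul_of_one_le_left
      (show 0 ≤ T.z o * T.mu (!o) * T.z o ^ a + T.l o * T.z o ^ b by positivity) (hK1 (a + b) n)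
    rw [valM]
    refine le_trans ?_ h2
    have h5 : 0 ≤ T.l o * T.z o ^ b := by positivity
    split_ifs with ha
    · rw [ha, pow_zero]; linarith [hvM o]
    · rw [mul_zero]; positivity
  refine ⟨δ * v / 2, by positivity, fun o a b n => ?_, fun o a b n => ?_⟩
  · have s1 := T.stepVal_weight_le (ε := δ * v / 2) (by positivity) hy ht o a b n
    have s2 := T.stepVal_weight_le (ε := δ * v / 2) (by positivity) hy ht o b a n
    rw [add_comm b a, min_comm b a] at s2
    have h1 := T.t_pos o
    have h2 := T.t_pos (!o)
    refine (add_le_add_three le_rfl s1 s2).trans ?_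
    have e1 : T.weightU (δ * v / 2) y o a b (n + 1) = T.t o ^ n * T.t (!o) ^ (a + b) *
        (T.t o * T.valU (upperFactor T.ζ) o a b (n + 1) +
          δ * v / 2 * (T.t o * (71 / 50 * y ^ min a b))) := by
      rw [weightU]; ring
    rw [e1, weightU, ← mul_add, ← mul_add, mul_left_comm (T.lam + δ)]
    refine mul_le_mul_of_nonneg_left ?_ (by positivity)
    have h3 := T.super_valU hK hK2 hK3 o a b n
    have h4 := mul_le_mul_of_nonneg_left (cornerU o a b n) hδ.le
    have hP : 0 < y ^ min a b := by positivity
    have h5 : T.t o * (71 / 50 * y ^ min a b) + (y * y ^ min a b + y * y ^ min a b) ≤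
        (T.lam + δ) * (71 / 50 * y ^ min a b) := by
      have : T.t o * (71 / 50) + (y + y) ≤ (T.lam + δ) * (71 / 50) := by linarith [ht o]
      have := mul_le_mul_of_nonneg_right this hP.le
      linarith
    have h6 := mul_le_mul_of_nonneg_left h5 (show 0 ≤ δ * v / 2 by positivity)
    have e2 : ∀ a : ℕ, (if a = 0 then (2 : ℝ) else 0) = 2 * (if a = 0 then 1 else 0) := by
      intro a; split_ifs <;> simp
    rw [e2 a, e2 b]
    linarith
  · have s1 := T.stepVal_weight_le (ε := δ * v / 2) (by positivity) hy ht o a b n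
    have h1 := T.t_pos o
    have h2 := T.t_pos (!o)
    refine (add_le_add le_rfl s1).trans ?_
    have e1 : T.weightU (δ * v / 2) y o a b (n + 1) = T.t o ^ n * T.t (!o) ^ (a + b) *
        (T.t o * T.valU (upperFactor T.ζ) o a b (n + 1) +
          δ * v / 2 * (T.t o * (71 / 50 * y ^ min a b))) := by
      rw [weightU]; ring
    rw [e1, weightM, ← mul_add, mul_left_comm (T.lam + δ)]
    refine mul_le_mul_of_nonneg_left ?_ (by positivity)
    have h3 := T.super_valM hK hK2 hK3 o a b n
    have h4 := mul_le_mul_of_nonneg_left (cornerM o a b n) hδ.le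
    have hP : 0 < y ^ min a b := by positivity
    have h5 : T.t o * (71 / 50 * y ^ min a b) + y * y ^ min a b ≤
        (T.lam + δ) * y ^ min a b := by
      have : T.t o * (71 / 50) + y ≤ T.lam + δ := by linarith [ht o]
      have := mul_le_mul_of_nonneg_right this hP.le
      linarith
    have h6 := mul_le_mul_of_nonneg_left h5 (show 0 ≤ δ * v / 2 by positivity)
    have e2 : ∀ a : ℕ, (if a = 0 then (2 : ℝ) else 0) = 2 * (if a = 0 then 1 else 0) := by
      intro a; split_ifs <;> simp
    rw [e2 a]
    linarith

end Tilt

/-! ### Counting prudent words -/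

/-- The extent of the bounding box along the axis `o`. -/
def extent (w : List Dir) (o : Bool) : ℕ := gap w (o, true) + gap w (o, false)

/-- The distance from the endpoint of the path to the nearest corner of the box, along the side
on which it lies. -/
def cornerDist (w : List Dir) : ℕ :=
  min (gap w (perp (normal w))) (gap w (opp (perp (normal w))))

lemma gap_add_gap_opp (w : List Dir) (d : Dir) : gap w d + gap w (opp d) = extent w d.1 := by
  obtain ⟨_ | _, _ | _⟩ := d <;> simp [opp, extent, add_comm]

lemma extent_le_length : ∀ (w : List Dir) (o : Bool), extent w o ≤ w.length
  | [], o => by simp [extent, gap]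
  | e :: w, o => by
      have ih := extent_le_length w o
      rw [List.length_cons]
      by_cases h : o = e.1
      · subst h
        rw [← gap_add_gap_opp] at ih ⊢
        rw [gap_cons_self, gap_cons_opp]
        omega
      · rw [extent, gap_cons_perp h, gap_cons_perp h]
        exact ih.trans (Nat.le_succ _)

section Propagation

variable {F : List Dir → ℝ} {c : ℝ}

open Classical in
/-- A supersolution summed over the continuations of a set of paths. -/
lemma sum_extensions_le (hc : 0 ≤ c)
    (h : ∀ w, Prudent w → w ≠ [] →
      ∑ d ∈ Finset.univ.filter (Allowed w), F (d :: w) ≤ c * F w)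
    (E : List Dir → Prop) {k : ℕ} (hk : 1 ≤ k) (m : ℕ) :
    ∑ w ∈ words (k + m), (if E (w.drop m) then F w else 0) ≤
      c ^ m * ∑ w ∈ words k, if E w then F w else 0 := by
  induction m with
  | zero => simp
  | succ m ih =>
    rw [← add_assoc, sum_words_succ, pow_succ', mul_assoc]
    refine le_trans ?_ (mul_le_mul_of_nonneg_left ih hc)
    rw [Finset.mul_sum]
    refine Finset.sum_le_sum fun w hw => ?_
    obtain ⟨h1, h2⟩ := mem_words.1 hw
    simp only [List.drop_succ_cons]
    split_ifs with hE
    · exact h w h2 (by rintro rfl; simp at h1; omega)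
    · simp

open Classical in
lemma sum_words_le (hc : 0 ≤ c)
    (h : ∀ w, Prudent w → w ≠ [] →
      ∑ d ∈ Finset.univ.filter (Allowed w), F (d :: w) ≤ c * F w)
    (m : ℕ) : ∑ w ∈ words (1 + m), F w ≤ c ^ m * ∑ w ∈ words 1, F w := by
  have := sum_extensions_le hc h (fun _ => True) le_rfl m
  simpa using this

open Classical in
lemma le_sum_words (hc : 0 ≤ c)
    (h : ∀ w, Prudent w → w ≠ [] →
      c * F w ≤ ∑ d ∈ Finset.univ.filter (Allowed w), F (d :: w))
    (m : ℕ) : c ^ m * ∑ w ∈ words 1, F w ≤ ∑ w ∈ words (1 + m), F w := by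
  have := sum_words_le (F := fun w => -F w) hc (fun w h1 h2 => by
    rw [Finset.sum_neg_distrib]; linarith [h w h1 h2]) m
  simp only [Finset.sum_neg_distrib] at this
  linarith

end Propagation

/-- The state functions bounded below by a function of the geometry of the box. -/
lemma le_stateVal {FU FM : Bool → ℕ → ℕ → ℕ → ℝ} {B : Bool → ℕ → ℕ → ℕ → ℝ}
    (hU : ∀ o a b n, B o (a + b) (min a b) n ≤ FU o a b n)
    (hM : ∀ o a b n, B o (a + b) (min a b) n ≤ FM o a b n) {w : List Dir} (hw : Prudent w)
    (hne : w ≠ []) :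
    B (normal w).1 (extent w !(normal w).1) (cornerDist w) (extent w (normal w).1) ≤
      stateVal FU FM w := by
  cases w with
  | nil => exact absurd rfl hne
  | cons e w =>
    obtain ⟨h1, h2, -⟩ := prudent_structure w e hw
    have h4 := gap_add_gap_opp (e :: w) (normal (e :: w))
    rw [h1, zero_add] at h4
    have h3 := gap_add_gap_opp (e :: w) (perp (normal (e :: w)))
    rw [stateVal, ← h4, cornerDist, show (!(normal (e :: w)).1) = (perp (normal (e :: w))).1 from rfl,
      ← h3]
    split_ifs with hg
    · rw [show normal (e :: w) = e by rw [normal, if_pos hg]]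
      exact hU _ _ _ _
    · have hn : normal (e :: w) = normal w := by rw [normal, if_neg hg]
      rw [hn] at *
      rcases eq_perp_or (Ne.symm (h2 hg)) with h | h
      · rw [← h]
        exact hM _ _ _ _
      · rw [show perp (normal w) = opp e by rw [h, opp_opp], opp_opp, add_comm (gap _ (opp e)),
          min_comm (gap _ (opp e))]
        exact hM _ _ _ _

namespace Tilt

/-- The product of the weights of the outward steps, a function of the extents of the box. -/
noncomputable def boxWeight (T : Tilt) (w : List Dir) : ℝ :=
  T.t true ^ extent w true * T.t false ^ extent w false

lemma boxWeight_eq (T : Tilt) (w : List Dir) (o : Bool) :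
    T.t o ^ extent w o * T.t (!o) ^ extent w (!o) = T.boxWeight w := by
  cases o
  · exact mul_comm _ _
  · rfl

/-- The total weight of the states of all prudent words. -/
noncomputable def weight (T : Tilt) (ε y : ℝ) : List Dir → ℝ :=
  stateVal (T.weightU ε y) (T.weightM ε y)

lemma valU_nonneg (T : Tilt) (o : Bool) (a b n : ℕ) : 0 ≤ T.valU (upperFactor T.ζ) o a b n := by
  have h1 := T.u_pos o
  have h2 := T.z_pos o
  have h3 : 0 < upperFactor T.ζ (a + b) n := Real.exp_pos _
  rw [valU]; positivity

lemma valM_nonneg (T : Tilt) (o : Bool) (a b n : ℕ) : 0 ≤ T.valM (upperFactor T.ζ) o a b n := by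
  have h1 := T.l_pos o
  have h2 := T.z_pos o
  have h4 := T.mu_pos (!o)
  have h3 : 0 < upperFactor T.ζ (a + b) n := Real.exp_pos _
  rw [valM]; positivity

lemma le_weight (T : Tilt) {ε y : ℝ} (hε : 0 ≤ ε) (hy : 0 ≤ y) {w : List Dir} (hw : Prudent w)
    (hne : w ≠ []) : ε * (T.boxWeight w * y ^ cornerDist w) ≤ T.weight ε y w := by
  have hp : ∀ o (i j : ℕ), 0 ≤ T.t o ^ i * T.t (!o) ^ j := fun o i j => by
    have h1 := T.t_pos o
    have h2 := T.t_pos (!o)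
    positivity
  have := le_stateVal (FU := T.weightU ε y) (FM := T.weightM ε y)
    (B := fun o ℓ r n => T.t o ^ n * T.t (!o) ^ ℓ * (ε * y ^ r))
    (fun o a b n => mul_le_mul_of_nonneg_left (by
      have := T.valU_nonneg o a b n
      have : 0 ≤ ε * y ^ min a b := by positivity
      linarith) (hp _ _ _))
    (fun o a b n => mul_le_mul_of_nonneg_left (by
      have := T.valM_nonneg o a b n
      linarith) (hp _ _ _)) hw hne
  simp only [boxWeight_eq] at this
  rw [weight]
  linarith

lemma weight_nonneg (T : Tilt) {ε y : ℝ} (hε : 0 ≤ ε) (hy : 0 ≤ y) {w : List Dir}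
    (hw : Prudent w) (hne : w ≠ []) : 0 ≤ T.weight ε y w := by
  refine le_trans ?_ (T.le_weight hε hy hw hne)
  have h1 := T.t_pos
  exact mul_nonneg hε (mul_nonneg (mul_nonneg (pow_nonneg (h1 _).le _) (pow_nonneg (h1 _).le _))
    (pow_nonneg hy _))

/-- For the untilted weight without the growing factor, all values are bounded. -/
lemma exists_weight_le (T : Tilt) (ht : ∀ o, T.t o = 1) {ε : ℝ} (hε : 0 ≤ ε) :
    ∃ C, ∀ w, T.weight ε 1 w ≤ C := by
  have hz1 : ∀ o (i : ℕ), T.z o ^ i ≤ 1 := fun o i => pow_le_one₀ (T.z_pos o).le (T.z_lt_one o).le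
  set K := Real.exp (2 / (1 - T.ζ)) with hKdef
  have hK0 : 0 ≤ K := (Real.exp_pos _).le
  have hK : ∀ ℓ n, upperFactor T.ζ ℓ n ≤ K := upperFactor_le T.ζ_pos T.ζ_lt_one
  have bU : ∀ o a b n, T.weightU ε 1 o a b n ≤ K * (T.u o * 2) + ε * (71 / 50) := by
    intro o a b n
    have h1 := T.u_pos o
    have h2 := T.z_pos o
    rw [weightU, ht, ht, one_pow, one_pow, one_pow, valU, one_mul, one_mul, mul_one]
    gcongr
    · exact hK _ _
    · linarith [hz1 o a, hz1 o b]
  have bM : ∀ o a b n, T.weightM ε 1 o a b n ≤ K * (T.z o * T.mu (!o) + T.l o) + ε := by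
    intro o a b n
    have h1 := T.l_pos o
    have h2 := T.z_pos o
    have h4 := T.mu_pos (!o)
    rw [weightM, ht, ht, one_pow, one_pow, one_pow, valM, one_mul, one_mul, mul_one]
    have e1 : T.z o * T.mu (!o) * T.z o ^ a ≤ T.z o * T.mu (!o) :=
      mul_le_of_le_one_right (by positivity) (hz1 o a)
    have e2 : T.l o * T.z o ^ b ≤ T.l o := mul_le_of_le_one_right h1.le (hz1 o b)
    exact add_le_add_left (mul_le_mul (hK _ _) (add_le_add e1 e2) (by positivity) hK0) _
  have pU : ∀ o, 0 ≤ K * (T.u o * 2) + ε * (71 / 50) := fun o => by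
    have := T.u_pos o; positivity
  have pM : ∀ o, 0 ≤ K * (T.z o * T.mu (!o) + T.l o) + ε := fun o => by
    have := T.l_pos o; have := T.z_pos o; have := T.mu_pos (!o); positivity
  refine ⟨∑ o, ((K * (T.u o * 2) + ε * (71 / 50)) + (K * (T.z o * T.mu (!o) + T.l o) + ε)),
    fun w => ?_⟩
  have hsum : ∀ o : Bool, (K * (T.u o * 2) + ε * (71 / 50)) +
      (K * (T.z o * T.mu (!o) + T.l o) + ε) ≤
      ∑ o, ((K * (T.u o * 2) + ε * (71 / 50)) + (K * (T.z o * T.mu (!o) + T.l o) + ε)) :=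
    fun o => Finset.single_le_sum (f := fun o => (K * (T.u o * 2) + ε * (71 / 50)) +
      (K * (T.z o * T.mu (!o) + T.l o) + ε)) (fun o _ => add_nonneg (pU o) (pM o))
      (Finset.mem_univ o)
  cases w with
  | nil => exact (add_nonneg (pU true) (pM true)).trans (hsum true)
  | cons e w =>
    rw [weight, stateVal]
    split_ifs
    · exact (bU _ _ _ _).trans (le_trans (by linarith [pM e.1]) (hsum e.1))
    · exact (bM _ _ _ _).trans (le_trans (by linarith [pU (normal w).1]) (hsum (normal w).1))

open Classical in
/-- The exponential Chebyshev inequality at time `k`, combined with the bound for the number of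
continuations up to time `k + m`. -/
lemma exists_count_le (T T₀ : Tilt) (ht : ∀ o, T.t o ≤ 101 / 100) (hlam : 49 / 20 ≤ T.lam)
    (ht₀ : ∀ o, T₀.t o = 1) (hlam₀ : 49 / 20 ≤ T₀.lam) {δ : ℝ} (hδ : 0 < δ) :
    ∃ C > 0, ∀ k m : ℕ, 1 ≤ k → ∀ B : ℝ, ∀ E : List Dir → Prop,
      (∀ w ∈ words k, E w → B ≤ T.boxWeight w * (101 / 100) ^ cornerDist w) →
      B * ((words (k + m)).filter (fun w => E (w.drop m))).card ≤
        C * ((T.lam + δ) ^ k * (T₀.lam + δ) ^ m) := by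
  obtain ⟨ε, hε, hU, hM⟩ := T.exists_weight (y := 101 / 100) (by norm_num) le_rfl hδ ht hlam
  obtain ⟨ε₀, hε₀, hU₀, hM₀⟩ := T₀.exists_weight (y := 1) le_rfl (by norm_num) hδ
    (fun o => by rw [ht₀]; norm_num) hlam₀
  have hstep := fun w (h1 : Prudent w) h2 => sum_allowed_le (T.weightU_symm ε (101 / 100)) hU hM h1 h2
  have hstep₀ := fun w (h1 : Prudent w) h2 => sum_allowed_le (T₀.weightU_symm ε₀ 1) hU₀ hM₀ h1 h2
  obtain ⟨C₀, hC₀⟩ := T₀.exists_weight_le ht₀ hε₀.le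
  have hΛ : 1 ≤ T.lam + δ := by linarith
  have hΛ₀ : 0 ≤ T₀.lam + δ := by linarith
  have hb : ∀ w, T₀.boxWeight w = 1 := fun w => by simp [boxWeight, ht₀]
  have hne : ∀ {k w}, 1 ≤ k → w ∈ words k → Prudent w ∧ w ≠ [] := by
    intro k w hk hw
    obtain ⟨h1, h2⟩ := mem_words.1 hw
    exact ⟨h2, by rintro rfl; simp at h1; omega⟩
  set S := ∑ w ∈ words 1, T.weight ε (101 / 100) w
  have hS : 0 ≤ S := Finset.sum_nonneg fun w hw =>
    T.weight_nonneg hε.le (by norm_num) (hne le_rfl hw).1 (hne le_rfl hw).2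
  refine ⟨(|C₀| / ε₀) * (S / ε) + 1, by positivity, fun k m hk B E hE => ?_⟩
  rcases le_or_gt B 0 with hB | hB
  · refine (mul_nonpos_of_nonpos_of_nonneg hB (Nat.cast_nonneg _)).trans ?_
    have : 0 ≤ T.lam + δ := by linarith
    positivity
  -- The number of continuations of a path is at most `|C₀| / ε₀ * (T₀.lam + δ) ^ m`.
  have h1 : ε₀ * ((words (k + m)).filter (fun w => E (w.drop m))).card ≤
      (T₀.lam + δ) ^ m * (|C₀| * ((words k).filter E).card) := by
    calc ε₀ * (((words (k + m)).filter (fun w => E (w.drop m))).card : ℝ)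
        = ∑ w ∈ words (k + m), if E (w.drop m) then ε₀ else 0 := by
          rw [← Finset.sum_filter, Finset.sum_const, nsmul_eq_mul, mul_comm]
      _ ≤ ∑ w ∈ words (k + m), if E (w.drop m) then T₀.weight ε₀ 1 w else 0 := by
          refine Finset.sum_le_sum fun w hw => ?_
          split_ifs
          · have := T₀.le_weight hε₀.le zero_le_one (hne (by omega) hw).1 (hne (by omega) hw).2
            rwa [hb, one_pow, mul_one, mul_one] at this
          · exact le_rfl
      _ ≤ (T₀.lam + δ) ^ m * ∑ w ∈ words k, if E w then T₀.weight ε₀ 1 w else 0 :=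
          sum_extensions_le hΛ₀ hstep₀ E hk m
      _ ≤ (T₀.lam + δ) ^ m * ∑ w ∈ words k, if E w then |C₀| else 0 := by
          refine mul_le_mul_of_nonneg_left (Finset.sum_le_sum fun w _ => ?_) (by positivity)
          split_ifs
          · exact (hC₀ w).trans (le_abs_self _)
          · exact le_rfl
      _ = _ := by rw [← Finset.sum_filter, Finset.sum_const, nsmul_eq_mul, mul_comm (|C₀|)]
  have h2 : ε * B * ((words k).filter E).card ≤ (T.lam + δ) ^ k * S := by
    obtain ⟨j, rfl⟩ := Nat.exists_eq_add_of_le hk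
    calc ε * B * (((words (1 + j)).filter E).card : ℝ)
        = ∑ w ∈ words (1 + j), if E w then ε * B else 0 := by
          rw [← Finset.sum_filter, Finset.sum_const, nsmul_eq_mul, mul_comm]
      _ ≤ ∑ w ∈ words (1 + j), T.weight ε (101 / 100) w := by
          refine Finset.sum_le_sum fun w hw => ?_
          have h := hne (by omega) hw
          split_ifs with hEw
          · exact (mul_le_mul_of_nonneg_left (hE w hw hEw) hε.le).trans
              (T.le_weight hε.le (by norm_num) h.1 h.2)
          · exact T.weight_nonneg hε.le (by norm_num) h.1 h.2
      _ ≤ (T.lam + δ) ^ j * S := by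
          exact sum_words_le (by linarith) hstep j
      _ ≤ (T.lam + δ) ^ (1 + j) * S :=
          mul_le_mul_of_nonneg_right (pow_le_pow_right₀ hΛ (by omega)) hS
  have hΛk : 0 ≤ (T.lam + δ) ^ k := by positivity
  have hΛm : 0 ≤ (T₀.lam + δ) ^ m := by positivity
  have h3 : (((words (k + m)).filter (fun w => E (w.drop m))).card : ℝ) ≤
      (T₀.lam + δ) ^ m * (|C₀| * ((words k).filter E).card) / ε₀ := by
    rw [le_div_iff₀ hε₀]; linarith
  have h4 : B * (((words k).filter E).card : ℝ) ≤ (T.lam + δ) ^ k * S / ε := by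
    rw [le_div_iff₀ hε]; linarith
  calc B * (((words (k + m)).filter (fun w => E (w.drop m))).card : ℝ)
      ≤ B * ((T₀.lam + δ) ^ m * (|C₀| * ((words k).filter E).card) / ε₀) :=
        mul_le_mul_of_nonneg_left h3 hB.le
    _ = (T₀.lam + δ) ^ m * (|C₀| / ε₀) * (B * ((words k).filter E).card) := by ring
    _ ≤ (T₀.lam + δ) ^ m * (|C₀| / ε₀) * ((T.lam + δ) ^ k * S / ε) :=
        mul_le_mul_of_nonneg_left h4 (by positivity)
    _ = ((|C₀| / ε₀) * (S / ε)) * ((T.lam + δ) ^ k * (T₀.lam + δ) ^ m) := by ring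
    _ ≤ _ := mul_le_mul_of_nonneg_right (by linarith) (by positivity)

end Tilt

/-! ### The number of prudent paths from below -/

/-- The correction for a finite box that turns the sum of the eigenfunctions at two corners into
a subsolution. -/
noncomputable def lowerFactor (C z : ℝ) (ℓ n : ℕ) : ℝ := Real.exp (-(C * (z ^ ℓ + z ^ n)))

open Classical in
lemma Tilt.exists_le_card_words (T : Tilt) (ht : ∀ o, T.t o = 1) (hmu : ∀ o, T.mu o = 1) :
    ∃ c > 0, ∀ L, 1 ≤ L → c * T.lam ^ L ≤ (words L).card := by
  have hz : ∀ o o', T.z o = T.z o' := fun o o' => by simp [z, hmu]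
  have hl : ∀ o o', T.l o = T.l o' := fun o o' => by simp [l, hmu, hz o o']
  set z := T.z true with hzdef
  set l := T.l true with hldef
  have hz0 : 0 < z := T.z_pos true
  have hz1 : z < 1 := T.z_lt_one true
  have hl0 : 0 < l := T.l_pos true
  set C := l * z / (1 - z) with hC
  have hz1' : 0 < 1 - z := by linarith
  have hC0 : 0 ≤ C := by positivity
  set K := lowerFactor C z with hK
  have hKpos : ∀ ℓ n, 0 < K ℓ n := fun ℓ n => Real.exp_pos _
  have hK1 : ∀ ℓ n, K ℓ n ≤ 1 := fun ℓ n => Real.exp_le_one_iff.2 (by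
    have : 0 ≤ C * (z ^ ℓ + z ^ n) := by positivity
    linarith)
  have h1 : ∀ ℓ n, K ℓ n ≤ K ℓ (n + 1) := fun ℓ n => Real.exp_le_exp.2 (by
    have := mul_le_mul_of_nonneg_left (pow_le_pow_of_le_one hz0.le hz1.le (Nat.le_add_right n 1)) hC0
    linarith)
  have h2 : ∀ o ℓ n, K ℓ n * (T.mu (!o) + T.l o * T.z o ^ (ℓ + 1)) ≤ K n (ℓ + 1) * T.mu (!o) := by
    intro o ℓ n
    rw [hmu, hl o true, hz o true, mul_one, ← hldef, ← hzdef]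
    have e1 : 1 + l * z ^ (ℓ + 1) ≤ Real.exp (l * z ^ (ℓ + 1)) := by
      linarith [Real.add_one_le_exp (l * z ^ (ℓ + 1))]
    refine (mul_le_mul_of_nonneg_left e1 (hKpos _ _).le).trans (le_of_eq ?_)
    simp only [hK, lowerFactor]
    rw [← Real.exp_add]
    congr 1
    rw [hC]
    field_simp
    ring
  have hstep : ∀ o a b n, T.valStep K o a b n = stepVal (T.valU K) (T.valM K) o a b n := by
    intro o a b n
    rw [valStep, stepVal, ht, one_mul]
  set V := stateVal (T.valU K) (T.valM K) with hV
  have hsub : ∀ w, Prudent w → w ≠ [] →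
      T.lam * V w ≤ ∑ d ∈ Finset.univ.filter (Allowed w), V (d :: w) := by
    intro w hw hne
    refine le_sum_allowed (fun o a b n => ?_) (fun o a b n => ?_) (fun o a b n => ?_) hw hne
    · simp only [valU, add_comm b a, add_comm (T.z o ^ b)]
    · have := T.sub_valU h1 h2 (fun ℓ n => (hKpos ℓ n).le) o a b n
      rwa [hstep, hstep, ht, one_mul] at this
    · have := T.sub_valM h1 h2 (fun ℓ n => (hKpos ℓ n).le) o a b n
      rwa [hstep, ht, one_mul] at this
  have hpow : ∀ i : ℕ, z ^ i ≤ 1 := fun i => pow_le_one₀ hz0.le hz1.le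
  have hu : ∀ o, T.u o = T.u true := fun o => by simp [u, hmu, hz o true, hl o true]
  have hu0 := T.u_pos true
  set D := T.u true * 2 + (z + l) with hD
  have hD0 : 0 < D := by positivity
  have hVD : ∀ w, V w ≤ D := by
    intro w
    cases w with
    | nil => exact hD0.le
    | cons e w =>
      rw [hV, stateVal]
      split_ifs
      · rw [valU, hu, hz _ true, ← hzdef]
        refine (mul_le_of_le_one_left (by positivity) (hK1 _ _)).trans ?_
        have := mul_le_mul_of_nonneg_left (add_le_add (hpow (gap (e :: w) (perp e)))
          (hpow (gap (e :: w) (opp (perp e))))) hu0.le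
        linarith
      · rw [valM, hl _ true, hz _ true, hmu, ← hzdef, ← hldef, mul_one]
        refine (mul_le_of_le_one_left (by positivity) (hK1 _ _)).trans ?_
        have := mul_le_mul_of_nonneg_left (hpow (gap (e :: w) e)) hz0.le
        have := mul_le_mul_of_nonneg_left (hpow (gap (e :: w) (opp e))) hl0.le
        linarith
  have hVpos : ∀ e w, 0 < V (e :: w) := by
    intro e w
    rw [hV, stateVal]
    split_ifs
    · rw [valU, hu, hz _ true, ← hzdef]
      exact mul_pos (hKpos _ _) (by positivity)
    · rw [valM, hl _ true, hz _ true, hmu, ← hzdef, ← hldef, mul_one]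
      exact mul_pos (hKpos _ _) (by positivity)
  have hS : 0 < ∑ w ∈ words 1, V w := by
    refine Finset.sum_pos (fun w hw => ?_) ⟨[(true, true)], mem_words.2 ⟨rfl, trivial, ?_⟩⟩
    · cases w with
      | nil => simpa using (mem_words.1 hw).1
      | cons e w => exact hVpos e w
    · exact allowed_of_gap_eq_zero rfl
  have hlam := T.lam_pos
  refine ⟨(∑ w ∈ words 1, V w) / (D * T.lam), by positivity, fun L hL => ?_⟩
  obtain ⟨m, rfl⟩ := Nat.exists_eq_add_of_le hL
  have h3 := le_sum_words hlam.le hsub m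
  have h4 : ∑ w ∈ words (1 + m), V w ≤ (words (1 + m)).card * D := by
    rw [← nsmul_eq_mul]
    exact Finset.sum_le_card_nsmul _ _ _ fun w _ => hVD w
  rw [div_mul_eq_mul_div, div_le_iff₀ (by positivity), pow_add, pow_one]
  calc (∑ w ∈ words 1, V w) * (T.lam * T.lam ^ m)
      = T.lam * (T.lam ^ m * ∑ w ∈ words 1, V w) := by ring
    _ ≤ T.lam * ((words (1 + m)).card * D) := mul_le_mul_of_nonneg_left (h3.trans h4) hlam.le
    _ = _ := by ring

/-! ### Exponential tail estimates -/

open Classical in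
/-- Large deviations of a linear function of the extents of the box: if the logarithms of the
step weights along a curve of tilts have derivatives `P`, `Q` and that of the eigenvalue has
derivative `r` at the untilted point, then `P * height + Q * width` grows at most at speed `r`. -/
lemma exists_tail_extent (T₀ : Tilt) (ht₀ : ∀ o, T₀.t o = 1) (hlam₀ : 49 / 20 < T₀.lam)
    {ll lp lq : ℝ → ℝ} {r P Q : ℝ} (hl0 : ll 0 = 0) (hp0 : lp 0 = 0) (hq0 : lq 0 = 0)
    (hl : HasDerivAt ll r 0) (hp : HasDerivAt lp P 0) (hq : HasDerivAt lq Q 0)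
    (hT : ∀ᶠ s in 𝓝 (0 : ℝ), ∃ T : Tilt, T.lam = T₀.lam * Real.exp (ll s) ∧
      T.t true = Real.exp (lp s) ∧ T.t false = Real.exp (lq s)) {η : ℝ} (hη : 0 < η) :
    ∃ C > 0, ∃ ρ, 0 < ρ ∧ ρ < 1 ∧ ∀ k m : ℕ, 1 ≤ k →
      (((words (k + m)).filter (fun w => r * k + η * (k + m : ℕ) ≤
        P * extent (w.drop m) true + Q * extent (w.drop m) false)).card : ℝ) ≤
        C * (ρ * T₀.lam) ^ (k + m) := by
  have hη' : 0 < η / 16 := by positivity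
  have o1 := (hasDerivAt_iff_isLittleO.1 hl).def hη'
  have o2 := (hasDerivAt_iff_isLittleO.1 hp).def hη'
  have o3 := (hasDerivAt_iff_isLittleO.1 hq).def hη'
  simp only [hl0, hp0, hq0, sub_zero, smul_eq_mul, Real.norm_eq_abs] at o1 o2 o3
  have hlog : 0 < Real.log (101 / 100) := Real.log_pos (by norm_num)
  have c2 : ∀ᶠ s in 𝓝 (0 : ℝ), lp s ≤ Real.log (101 / 100) :=
    (hp.continuousAt.eventually_lt_const (by rwa [hp0])).mono fun s h => h.le
  have c3 : ∀ᶠ s in 𝓝 (0 : ℝ), lq s ≤ Real.log (101 / 100) :=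
    (hq.continuousAt.eventually_lt_const (by rwa [hq0])).mono fun s h => h.le
  have c1 : ∀ᶠ s in 𝓝 (0 : ℝ), 49 / 20 ≤ T₀.lam * Real.exp (ll s) := by
    have : ContinuousAt (fun s => T₀.lam * Real.exp (ll s)) 0 :=
      continuousAt_const.mul hl.continuousAt.rexp
    exact (this.eventually_const_lt (by simpa [hl0] using hlam₀)).mono fun s h => h.le
  obtain ⟨s, ⟨o1, o2, o3, c1, c2, c3, T, hT1, hT2, hT3⟩, hs⟩ :=
    (((o1.and (o2.and (o3.and (c1.and (c2.and (c3.and hT)))))).filter_mono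
      (nhdsWithin_le_nhds (s := Set.Ioi (0 : ℝ)))).and self_mem_nhdsWithin).exists
  rw [abs_of_pos hs] at o1 o2 o3
  set x := s * η / 8 with hx
  have hx0 : 0 < x := by positivity
  have htT : ∀ o, T.t o ≤ 101 / 100 := by
    have e : Real.exp (Real.log (101 / 100)) = 101 / 100 := Real.exp_log (by norm_num)
    rintro (_ | _)
    · rw [hT3, ← e]; exact Real.exp_le_exp.2 c3
    · rw [hT2, ← e]; exact Real.exp_le_exp.2 c2
  obtain ⟨C, hC, hcount⟩ := T.exists_count_le T₀ htT (by rwa [hT1]) ht₀ hlam₀.le hx0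
  refine ⟨C, hC, Real.exp (-(3 * x)), Real.exp_pos _, Real.exp_lt_one_iff.2 (by linarith),
    fun k m hk => ?_⟩
  have hL : ((k + m : ℕ) : ℝ) = k + m := by push_cast; ring
  have hk0 : (0 : ℝ) ≤ k := k.cast_nonneg
  have hm0 : (0 : ℝ) ≤ m := m.cast_nonneg
  have key := hcount k m hk (Real.exp (ll s * k + 4 * x * (k + m)))
    (fun w => r * k + η * (k + m : ℕ) ≤ P * extent w true + Q * extent w false) ?_
  · -- A factor `1 + x ≤ exp x` accounts for the error in the growth rates.
    have grow : ∀ v : ℝ, 49 / 20 ≤ v → v + x ≤ v * Real.exp x := by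
      intro v hv
      have := Real.add_one_le_exp x
      nlinarith
    have g1 : (T.lam + x) ^ k ≤ (T₀.lam * Real.exp (ll s) * Real.exp x) ^ k := by
      rw [hT1]
      exact pow_le_pow_left₀ (by linarith) (grow _ c1) k
    have g2 : (T₀.lam + x) ^ m ≤ (T₀.lam * Real.exp x) ^ m :=
      pow_le_pow_left₀ (by linarith) (grow _ hlam₀.le) m
    have g3 : C * ((T.lam + x) ^ k * (T₀.lam + x) ^ m) ≤
        Real.exp (ll s * k + 4 * x * (k + m)) *
          (C * (Real.exp (-(3 * x)) * T₀.lam) ^ (k + m)) := by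
      have h0 : 0 ≤ T₀.lam + x := by linarith
      have h1 : 0 ≤ T₀.lam := by linarith
      calc C * ((T.lam + x) ^ k * (T₀.lam + x) ^ m)
          ≤ C * ((T₀.lam * Real.exp (ll s) * Real.exp x) ^ k * (T₀.lam * Real.exp x) ^ m) := by
            gcongr
        _ = _ := by
            simp only [mul_pow, pow_add, ← Real.exp_nat_mul]
            have e : Real.exp (ll s * k + 4 * x * (k + m)) = Real.exp (k * ll s) *
                Real.exp (k * x) * Real.exp (m * x) * (Real.exp (k * (3 * x)) *
                Real.exp (m * (3 * x))) := by
              simp only [← Real.exp_add]; congr 1; ring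
            have e1 : Real.exp (k * (3 * x)) * Real.exp (k * -(3 * x)) = 1 := by
              rw [← Real.exp_add, ← Real.exp_zero]; congr 1; ring
            have e2 : Real.exp (m * (3 * x)) * Real.exp (m * -(3 * x)) = 1 := by
              rw [← Real.exp_add, ← Real.exp_zero]; congr 1; ring
            rw [e]
            linear_combination (-(C * T₀.lam ^ k * T₀.lam ^ m * Real.exp (k * ll s) *
              Real.exp (k * x) * Real.exp (m * x))) * (e1 * (Real.exp (m * (3 * x)) *
                Real.exp (m * -(3 * x))) + e2)
    exact le_of_mul_le_mul_left (key.trans g3) (Real.exp_pos _)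
  · intro w hw hE
    obtain ⟨hlen, -⟩ := mem_words.1 hw
    have b1 : (extent w true : ℝ) ≤ k := by rw [← hlen]; exact_mod_cast extent_le_length w true
    have b2 : (extent w false : ℝ) ≤ k := by rw [← hlen]; exact_mod_cast extent_le_length w false
    have p1 : (0 : ℝ) ≤ extent w true := Nat.cast_nonneg _
    have p2 : (0 : ℝ) ≤ extent w false := Nat.cast_nonneg _
    rw [Tilt.boxWeight, hT2, hT3, ← Real.exp_nat_mul, ← Real.exp_nat_mul, ← Real.exp_add]
    have one_le : (1 : ℝ) ≤ (101 / 100) ^ cornerDist w := one_le_pow₀ (by norm_num)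
    refine le_trans ?_ (le_mul_of_one_le_right (Real.exp_pos _).le one_le)
    refine Real.exp_le_exp.2 ?_
    have q1 := (abs_le.1 o1).2
    have q2 := (abs_le.1 o2).1
    have q3 := (abs_le.1 o3).1
    have r1 := mul_le_mul_of_nonneg_right q1 hk0
    have r2 := mul_le_mul_of_nonneg_right q2 p1
    have r3 := mul_le_mul_of_nonneg_right q3 p2
    have r4 := mul_le_mul_of_nonneg_left hE hs.le
    have hsη : 0 ≤ s * η := by positivity
    have r5 := mul_le_mul_of_nonneg_left b1 hsη
    have r6 := mul_le_mul_of_nonneg_left b2 hsη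
    have r7 := mul_nonneg hsη hm0
    have r8 := mul_nonneg hsη hk0
    rw [hL] at r4
    rw [hx]
    nlinarith

open Classical in
/-- The two-sided version of `exists_tail_extent`. -/
lemma exists_tail_extent_abs (T₀ : Tilt) (ht₀ : ∀ o, T₀.t o = 1) (hlam₀ : 49 / 20 < T₀.lam)
    {ll lp lq : ℝ → ℝ} {r P Q : ℝ} (hl0 : ll 0 = 0) (hp0 : lp 0 = 0) (hq0 : lq 0 = 0)
    (hl : HasDerivAt ll r 0) (hp : HasDerivAt lp P 0) (hq : HasDerivAt lq Q 0)
    (hT : ∀ᶠ s in 𝓝 (0 : ℝ), ∃ T : Tilt, T.lam = T₀.lam * Real.exp (ll s) ∧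
      T.t true = Real.exp (lp s) ∧ T.t false = Real.exp (lq s)) {η : ℝ} (hη : 0 < η) :
    ∃ C > 0, ∃ ρ, 0 < ρ ∧ ρ < 1 ∧ ∀ k m : ℕ, 1 ≤ k →
      (((words (k + m)).filter (fun w => η * (k + m : ℕ) ≤
        |P * extent (w.drop m) true + Q * extent (w.drop m) false - r * k|)).card : ℝ) ≤
        C * (ρ * T₀.lam) ^ (k + m) := by
  obtain ⟨C₁, hC₁, ρ₁, hρ₁, hρ₁', h₁⟩ :=
    exists_tail_extent T₀ ht₀ hlam₀ hl0 hp0 hq0 hl hp hq hT hη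
  have hneg : ∀ {f : ℝ → ℝ} {c : ℝ}, HasDerivAt f c 0 → HasDerivAt (fun s => f (-s)) (-c) 0 := by
    intro f c hf
    have := HasDerivAt.comp (0 : ℝ) (h₂ := f) (h := fun s => -s) (by simpa using hf)
      (hasDerivAt_neg 0)
    simpa [Function.comp_def] using this
  have hT' : ∀ᶠ s in 𝓝 (0 : ℝ), ∃ T : Tilt, T.lam = T₀.lam * Real.exp (ll (-s)) ∧
      T.t true = Real.exp (lp (-s)) ∧ T.t false = Real.exp (lq (-s)) := by
    have : Tendsto (fun s : ℝ => -s) (𝓝 0) (𝓝 0) := by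
      simpa using (continuous_neg (G := ℝ)).tendsto 0
    exact this.eventually hT
  obtain ⟨C₂, hC₂, ρ₂, hρ₂, hρ₂', h₂⟩ :=
    exists_tail_extent T₀ ht₀ hlam₀ (by simpa using hl0) (by simpa using hp0)
      (by simpa using hq0) (hneg hl) (hneg hp) (hneg hq) hT' hη
  have hlam0 := T₀.lam_pos
  refine ⟨C₁ + C₂, by positivity, max ρ₁ ρ₂, lt_max_of_lt_left hρ₁, max_lt hρ₁' hρ₂',
    fun k m hk => ?_⟩
  have b1 := h₁ k m hk
  have b2 := h₂ k m hk
  have m1 : (ρ₁ * T₀.lam) ^ (k + m) ≤ (max ρ₁ ρ₂ * T₀.lam) ^ (k + m) := by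
    gcongr; exact le_max_left _ _
  have m2 : (ρ₂ * T₀.lam) ^ (k + m) ≤ (max ρ₁ ρ₂ * T₀.lam) ^ (k + m) := by
    gcongr; exact le_max_right _ _
  have hsub : (words (k + m)).filter (fun w => η * (k + m : ℕ) ≤
      |P * extent (w.drop m) true + Q * extent (w.drop m) false - r * k|) ⊆
      (words (k + m)).filter (fun w => r * k + η * (k + m : ℕ) ≤
        P * extent (w.drop m) true + Q * extent (w.drop m) false) ∪
      (words (k + m)).filter (fun w => -r * k + η * (k + m : ℕ) ≤
        -P * extent (w.drop m) true + -Q * extent (w.drop m) false) := by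
    intro w hw
    rw [Finset.mem_filter] at hw
    rw [Finset.mem_union, Finset.mem_filter, Finset.mem_filter]
    rcases le_abs.1 hw.2 with h | h
    · exact Or.inl ⟨hw.1, by linarith⟩
    · exact Or.inr ⟨hw.1, by linarith⟩
  have hcard : (((words (k + m)).filter (fun w => η * (k + m : ℕ) ≤
      |P * extent (w.drop m) true + Q * extent (w.drop m) false - r * k|)).card : ℝ) ≤ _ :=
    (Nat.cast_le.2 ((Finset.card_le_card hsub).trans (Finset.card_union_le _ _))).trans
      (Nat.cast_add _ _).le
  have := mul_le_mul_of_nonneg_left m1 hC₁.le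
  have := mul_le_mul_of_nonneg_left m2 hC₂.le
  linarith

open Classical in
/-- Being at macroscopic distance from all corners of the box is exponentially unlikely. -/
lemma exists_tail_cornerDist (T₀ : Tilt) (ht₀ : ∀ o, T₀.t o = 1) (hlam₀ : 49 / 20 < T₀.lam)
    {η : ℝ} (hη : 0 < η) :
    ∃ C > 0, ∃ ρ, 0 < ρ ∧ ρ < 1 ∧ ∀ k m : ℕ, 1 ≤ k →
      (((words (k + m)).filter (fun w => η * (k + m : ℕ) ≤ cornerDist (w.drop m))).card : ℝ) ≤
        C * (ρ * T₀.lam) ^ (k + m) := by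
  have hlog : 0 < Real.log (101 / 100) := Real.log_pos (by norm_num)
  set x := Real.log (101 / 100) * η / 2 with hx
  have hx0 : 0 < x := by positivity
  obtain ⟨C, hC, hcount⟩ := T₀.exists_count_le T₀ (fun o => by rw [ht₀]; norm_num) hlam₀.le
    ht₀ hlam₀.le hx0
  refine ⟨C, hC, Real.exp (-x), Real.exp_pos _, Real.exp_lt_one_iff.2 (by linarith), fun k m hk => ?_⟩
  have key := hcount k m hk (Real.exp (2 * x * (k + m : ℕ)))
    (fun w => η * (k + m : ℕ) ≤ cornerDist w) ?_
  · have g : (T₀.lam + x) ^ (k + m) ≤ (T₀.lam * Real.exp x) ^ (k + m) := by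
      refine pow_le_pow_left₀ (by linarith) ?_ _
      have := Real.add_one_le_exp x
      nlinarith
    refine le_of_mul_le_mul_left (key.trans ?_) (Real.exp_pos (2 * x * (k + m : ℕ)))
    rw [← pow_add]
    refine (mul_le_mul_of_nonneg_left g hC.le).trans (le_of_eq ?_)
    rw [mul_pow, mul_pow, ← Real.exp_nat_mul, ← Real.exp_nat_mul]
    have : Real.exp (2 * x * (k + m : ℕ)) * Real.exp ((k + m : ℕ) * -x) =
        Real.exp ((k + m : ℕ) * x) := by
      rw [← Real.exp_add]; congr 1; ring
    linear_combination -(C * T₀.lam ^ (k + m)) * this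
  · intro w hw hE
    have e : T₀.boxWeight w = 1 := by simp [Tilt.boxWeight, ht₀]
    have e' : ((101 : ℝ) / 100) ^ cornerDist w =
        Real.exp (cornerDist w * Real.log (101 / 100)) := by
      rw [Real.exp_nat_mul, Real.exp_log (by norm_num)]
    rw [e, one_mul, e']
    refine Real.exp_le_exp.2 ?_
    have := mul_le_mul_of_nonneg_right hE hlog.le
    rw [hx]
    linarith

/-! ### The critical eigenvalue and two curves of tilts through it -/

/-- The tilt with equal weights on both axes and eigenvalue `lam`. -/
noncomputable def symTilt (lam : ℝ) (h : 2 < lam) : Tilt where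
  lam := lam
  mu := fun _ => 1
  lam_gt := by linarith
  mu_pos := fun _ => one_pos
  z_lt_one' := fun _ => by rw [mul_one, div_lt_one (by linarith)]; linarith

lemma symTilt_t {lam : ℝ} (h : 2 < lam) (o : Bool) :
    (symTilt lam h).t o = lam * (lam ^ 2 - 2) / (2 * (lam ^ 2 - 1)) := by
  have h0 : lam ≠ 0 := by linarith
  have h1 : lam ^ 2 - 2 ≠ 0 := by nlinarith
  have h2 : lam ^ 2 - 1 ≠ 0 := by nlinarith
  have hz : (symTilt lam h).z o = 2 / lam := by
    simp only [Tilt.z, symTilt, mul_one]; norm_num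
  have hl : (symTilt lam h).l o = lam / (lam ^ 2 - 2) := by
    rw [Tilt.l, hz]
    change 1 / (lam - 2 / lam) = _
    rw [show lam - 2 / lam = (lam ^ 2 - 2) / lam by field_simp]
    rw [one_div_div]
  have hu : (symTilt lam h).u o = 2 * (lam ^ 2 - 1) / (lam * (lam ^ 2 - 2)) := by
    rw [Tilt.u, hz, hl]
    change (1 + 1 + 2 / lam * (lam / (lam ^ 2 - 2))) / lam = _
    field_simp
    ring
  rw [Tilt.t, hu]
  change 1 / _ = _
  rw [one_div_div]

/-- The tilt with eigenvalue `lam` and ratio `A` of the weights on the two axes. -/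
noncomputable def asymTilt (lam A : ℝ) (h : 1 < lam) (hA : 0 < A) (h1 : A + 1 < lam)
    (h2 : 1 + A < lam * A) : Tilt where
  lam := lam
  mu := fun o => if o then A else 1
  lam_gt := h
  mu_pos := fun o => by cases o <;> simp [hA]
  z_lt_one' := fun o => by
    have : 0 < lam * A := by positivity
    cases o
    · simpa using (div_lt_one this).2 h2
    · simpa using (div_lt_one (by linarith)).2 h1

lemma asymTilt_t_true {lam A : ℝ} (h : 1 < lam) (hA : 0 < A) (h1 : A + 1 < lam)
    (h2 : 1 + A < lam * A) : (asymTilt lam A h hA h1 h2).t true =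
      lam / (1 + 1 / A + (1 + A) / (lam ^ 2 - 1 - A)) := by
  have h0 : lam ≠ 0 := by linarith
  have hd : lam ^ 2 - 1 - A ≠ 0 := by nlinarith
  have hz : (asymTilt lam A h hA h1 h2).z true = (1 + A) / lam := by
    simp [Tilt.z, asymTilt, add_comm]
  have hl : (asymTilt lam A h hA h1 h2).l true = A * lam / (lam ^ 2 - 1 - A) := by
    rw [Tilt.l, hz]
    change A / (lam - (1 + A) / lam) = _
    rw [show lam - (1 + A) / lam = (lam ^ 2 - 1 - A) / lam by field_simp; ring, div_div_eq_mul_div]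
  rw [Tilt.t, Tilt.u, hz, hl]
  change A / ((A + 1 + _) / lam) = _
  rw [div_div_eq_mul_div, show A + 1 + (1 + A) / lam * (A * lam / (lam ^ 2 - 1 - A)) =
    A * (1 + 1 / A + (1 + A) / (lam ^ 2 - 1 - A)) by field_simp, mul_div_mul_left _ _ hA.ne']

lemma asymTilt_t_false {lam A : ℝ} (h : 1 < lam) (hA : 0 < A) (h1 : A + 1 < lam)
    (h2 : 1 + A < lam * A) : (asymTilt lam A h hA h1 h2).t false =
      lam / (1 + A + (1 + A) / (lam ^ 2 * A - 1 - A)) := by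
  have h0 : lam ≠ 0 := by linarith
  have hd : lam ^ 2 * A - 1 - A ≠ 0 := by nlinarith [mul_pos hA (sub_pos.2 h)]
  have hz : (asymTilt lam A h hA h1 h2).z false = (1 + A) / (lam * A) := by
    simp [Tilt.z, asymTilt]
  have hl : (asymTilt lam A h hA h1 h2).l false = lam * A / (lam ^ 2 * A - 1 - A) := by
    rw [Tilt.l, hz]
    change 1 / (lam - (1 + A) / (lam * A)) = _
    rw [show lam - (1 + A) / (lam * A) = (lam ^ 2 * A - 1 - A) / (lam * A) by field_simp; ring,
      one_div_div]
  rw [Tilt.t, Tilt.u, hz, hl]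
  change 1 / ((1 + A + _) / lam) = _
  rw [one_div_div, show (1 + A) / (lam * A) * (lam * A / (lam ^ 2 * A - 1 - A)) =
    (1 + A) / (lam ^ 2 * A - 1 - A) by field_simp]

/-- The critical eigenvalue, the reciprocal of the smallest positive root of
`1 - 2 x - 2 x ^ 2 + 2 x ^ 3`. -/
lemma exists_critical : ∃ lam : ℝ, 49 / 20 < lam ∧ lam < 5 / 2 ∧
    lam ^ 3 - 2 * lam ^ 2 - 2 * lam + 2 = 0 := by
  have := intermediate_value_Ioo (a := (49 / 20 : ℝ)) (b := 5 / 2)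
    (f := fun x => x ^ 3 - 2 * x ^ 2 - 2 * x + 2) (by norm_num) (by fun_prop)
  obtain ⟨x, hx, hx0⟩ := this (show (0 : ℝ) ∈ _ by constructor <;> norm_num)
  exact ⟨x, hx.1, hx.2, hx0⟩

section Curves

variable {lam : ℝ} (h1 : 49 / 20 < lam) (h3 : lam ^ 3 - 2 * lam ^ 2 - 2 * lam + 2 = 0)

include h1 h3

lemma critical_t : lam * (lam ^ 2 - 2) / (2 * (lam ^ 2 - 1)) = 1 := by
  rw [div_eq_one_iff_eq (by nlinarith)]
  linarith

/-- Along the curve of symmetric tilts the weight of outward steps increases with the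
eigenvalue. -/
lemma exists_hasDerivAt_sym : ∃ P > 0, HasDerivAt
    (fun s => Real.log ((lam + s) * ((lam + s) ^ 2 - 2) / (2 * ((lam + s) ^ 2 - 1)))) P 0 := by
  have hd : lam ^ 2 - 1 ≠ 0 := by nlinarith
  have d0 : HasDerivAt (fun s : ℝ => lam + s) 1 0 := by
    simpa using (hasDerivAt_id (0 : ℝ)).const_add lam
  have d1 := (d0.mul ((d0.pow 2).sub_const 2)).div (((d0.pow 2).sub_const 1).const_mul 2)
    (by simpa using hd)
  have d2 := d1.log (by
    have := critical_t h1 h3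
    simp only [Pi.mul_apply, Pi.pow_apply, Pi.div_apply, add_zero]
    rw [this]; exact one_ne_zero)
  refine ⟨_, ?_, d2⟩
  have := critical_t h1 h3
  simp only [Pi.mul_apply, Pi.pow_apply, Pi.div_apply, add_zero]
  rw [this, div_one]
  refine div_pos ?_ (by positivity)
  push_cast
  nlinarith [pow_pos (show 0 < lam by linarith) 2, pow_pos (show 0 < lam by linarith) 4]

/-- Along the curve of asymmetric tilts with the critical eigenvalue, the weights of the outward
steps on the two axes change at opposite nonzero rates. -/
lemma exists_hasDerivAt_asym : ∃ κ ≠ 0, HasDerivAt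
    (fun s => Real.log (lam / (1 + 1 / (1 + s) + (1 + (1 + s)) / (lam ^ 2 - 1 - (1 + s))))) κ 0 ∧
    HasDerivAt (fun s => Real.log
      (lam / (1 + (1 + s) + (1 + (1 + s)) / (lam ^ 2 * (1 + s) - 1 - (1 + s))))) (-κ) 0 := by
  have hlam : lam ≠ 0 := by linarith
  have hd : lam ^ 2 - 1 - 1 ≠ 0 := by nlinarith
  have hD : 1 + 1 + (1 + 1) / (lam ^ 2 - 1 - 1) = lam := by
    field_simp
    nlinarith
  have d0 : HasDerivAt (fun s : ℝ => 1 + s) 1 0 := by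
    simpa using (hasDerivAt_id (0 : ℝ)).const_add 1
  have a1 : HasDerivAt (fun s : ℝ => 1 + 1 / (1 + s) + (1 + (1 + s)) / (lam ^ 2 - 1 - (1 + s)))
      (-1 + lam ^ 2 / (lam ^ 2 - 1 - 1) ^ 2) 0 := by
    have := (((hasDerivAt_const (0 : ℝ) (1 : ℝ)).div d0 (by simp)).const_add 1).add
      ((d0.const_add 1).div (d0.const_sub (lam ^ 2 - 1)) (by simpa using hd))
    refine this.congr_deriv ?_
    simp only [add_zero]
    field_simp
    ring
  have a2 : HasDerivAt (fun s : ℝ => 1 + (1 + s) +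
      (1 + (1 + s)) / (lam ^ 2 * (1 + s) - 1 - (1 + s)))
      (-(-1 + lam ^ 2 / (lam ^ 2 - 1 - 1) ^ 2)) 0 := by
    have := (d0.const_add 1).add
      ((d0.const_add 1).div (((d0.const_mul (lam ^ 2)).sub_const 1).sub d0) (by simpa using hd))
    refine this.congr_deriv ?_
    simp only [add_zero, mul_one, Pi.sub_apply]
    field_simp
    ring
  have key : -1 + lam ^ 2 / (lam ^ 2 - 1 - 1) ^ 2 < 0 := by
    have hlt : lam ^ 2 < (lam ^ 2 - 1 - 1) ^ 2 := by
      have : lam < lam ^ 2 - 1 - 1 := by nlinarith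
      exact pow_lt_pow_left₀ this (by linarith) two_ne_zero
    have := (div_lt_one (show 0 < (lam ^ 2 - 1 - 1) ^ 2 by positivity)).2 hlt
    linarith
  refine ⟨-(-1 + lam ^ 2 / (lam ^ 2 - 1 - 1) ^ 2) / lam, div_ne_zero (by linarith) hlam, ?_, ?_⟩
  · have := ((hasDerivAt_const (0 : ℝ) lam).div a1 (by simpa [hD] using hlam)).log
      (by simp [hD, hlam])
    refine this.congr_deriv ?_
    simp only [add_zero, div_one, Pi.div_apply, hD]
    field_simp
    ring
  · have := ((hasDerivAt_const (0 : ℝ) lam).div a2 (by simpa [hD] using hlam)).log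
      (by simp [hD, hlam])
    refine this.congr_deriv ?_
    simp only [add_zero, mul_one, Pi.div_apply, hD]
    field_simp
    ring

end Curves

/-! ### Concentration of the box and of the distance to its corners -/

open Classical in
/-- With exponentially small exceptional probability, the path is at distance `o(L)` from a corner
of the box, and the box is close to a square that grows at a deterministic speed. -/
theorem exists_concentration : ∃ c > 0, ∀ η > 0, ∃ C > 0, ∃ ρ, 0 < ρ ∧ ρ < 1 ∧
    ∀ k m : ℕ, 1 ≤ k →
      (((words (k + m)).filter (fun w => ¬ ((cornerDist (w.drop m) : ℝ) ≤ η * (k + m : ℕ) ∧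
        ∀ o, |(extent (w.drop m) o : ℝ) - c * k| ≤ η * (k + m : ℕ)))).card : ℝ) ≤
        C * ρ ^ (k + m) * (words (k + m)).card := by
  obtain ⟨lam, h1, h2, h3⟩ := exists_critical
  have hlam : 0 < lam := by linarith
  set T₀ := symTilt lam (by linarith) with hT₀
  have ht₀ : ∀ o, T₀.t o = 1 := fun o => by rw [hT₀, symTilt_t, critical_t h1 h3]
  obtain ⟨c₀, hc₀, hcard⟩ := T₀.exists_le_card_words ht₀ (fun _ => rfl)
  obtain ⟨P, hP, dP⟩ := exists_hasDerivAt_sym h1 h3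
  obtain ⟨κ, hκ, dκ, dκ'⟩ := exists_hasDerivAt_asym h1 h3
  have dl : HasDerivAt (fun s => Real.log ((lam + s) / lam)) (1 / lam) 0 := by
    have d0 : HasDerivAt (fun s : ℝ => lam + s) 1 0 := by
      simpa using (hasDerivAt_id (0 : ℝ)).const_add lam
    have := (d0.div_const lam).log (by simp [hlam.ne'])
    simpa [hlam.ne'] using this
  have small : ∀ᶠ s in 𝓝 (0 : ℝ), |s| < 1 / 10 := by
    filter_upwards [Metric.ball_mem_nhds (0 : ℝ) (show (0 : ℝ) < 1 / 10 by norm_num)] with s hs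
    rwa [mem_ball_zero_iff, Real.norm_eq_abs] at hs
  have symT : ∀ᶠ s in 𝓝 (0 : ℝ), ∃ T : Tilt,
      T.lam = T₀.lam * Real.exp (Real.log ((lam + s) / lam)) ∧
      T.t true = Real.exp (Real.log
        ((lam + s) * ((lam + s) ^ 2 - 2) / (2 * ((lam + s) ^ 2 - 1)))) ∧
      T.t false = Real.exp (Real.log
        ((lam + s) * ((lam + s) ^ 2 - 2) / (2 * ((lam + s) ^ 2 - 1)))) := by
    filter_upwards [small] with s hs
    have hs := abs_lt.1 hs
    have hlt : 2 < lam + s := by linarith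
    have ht := symTilt_t hlt
    refine ⟨symTilt (lam + s) hlt, ?_, ?_, ?_⟩
    · rw [Real.exp_log (div_pos (by linarith) hlam)]
      exact (mul_div_cancel₀ _ hlam.ne').symm
    · rw [← ht true, Real.exp_log (Tilt.t_pos _ _)]
    · rw [← ht false, Real.exp_log (Tilt.t_pos _ _)]
  have asymT : ∀ᶠ s in 𝓝 (0 : ℝ), ∃ T : Tilt, T.lam = T₀.lam * Real.exp ((fun _ => 0) s) ∧
      T.t true = Real.exp (Real.log
        (lam / (1 + 1 / (1 + s) + (1 + (1 + s)) / (lam ^ 2 - 1 - (1 + s))))) ∧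
      T.t false = Real.exp (Real.log
        (lam / (1 + (1 + s) + (1 + (1 + s)) / (lam ^ 2 * (1 + s) - 1 - (1 + s))))) := by
    filter_upwards [small] with s hs
    have hs := abs_lt.1 hs
    have a1 : 1 < lam := by linarith
    have a2 : 0 < 1 + s := by linarith
    have a3 : 1 + s + 1 < lam := by linarith
    have a4 : 1 + (1 + s) < lam * (1 + s) := by nlinarith
    refine ⟨asymTilt lam (1 + s) a1 a2 a3 a4, ?_, ?_, ?_⟩
    · rw [Real.exp_zero, mul_one]; rfl
    · rw [← asymTilt_t_true a1 a2 a3 a4, Real.exp_log (Tilt.t_pos _ _)]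
    · rw [← asymTilt_t_false a1 a2 a3 a4, Real.exp_log (Tilt.t_pos _ _)]
  have hD : lam / (1 + 1 + (1 + 1) / (lam ^ 2 - 1 - 1)) = 1 := by
    have hd : lam ^ 2 - 1 - 1 ≠ 0 := by nlinarith
    rw [show 1 + 1 + (1 + 1) / (lam ^ 2 - 1 - 1) = lam by field_simp; nlinarith, div_self hlam.ne']
  refine ⟨1 / (2 * P * lam), by positivity, fun η hη => ?_⟩
  obtain ⟨C₁, hC₁, ρ₁, hρ₁, hρ₁', b₁⟩ := exists_tail_cornerDist T₀ ht₀ h1 hη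
  obtain ⟨C₂, hC₂, ρ₂, hρ₂, hρ₂', b₂⟩ := exists_tail_extent_abs T₀ ht₀ h1
    (ll := fun s => Real.log ((lam + s) / lam)) (by simp [hlam.ne'])
    (by simp [critical_t h1 h3]) (by simp [critical_t h1 h3]) dl dP dP symT
    (η := P * η) (by positivity)
  obtain ⟨C₃, hC₃, ρ₃, hρ₃, hρ₃', b₃⟩ := exists_tail_extent_abs T₀ ht₀ h1
    (ll := fun _ => 0) rfl (by simp [hD]) (by simp [hD]) (hasDerivAt_const _ _) dκ dκ' asymT
    (η := |κ| * η) (by positivity)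
  set ρ := max ρ₁ (max ρ₂ ρ₃) with hρ
  have l1 : ρ₁ ≤ ρ := le_max_left _ _
  have l2 : ρ₂ ≤ ρ := (le_max_left _ _).trans (le_max_right _ _)
  have l3 : ρ₃ ≤ ρ := (le_max_right _ _).trans (le_max_right _ _)
  refine ⟨(C₁ + C₂ + C₃) / c₀, by positivity, ρ, hρ₁.trans_le l1,
    max_lt hρ₁' (max_lt hρ₂' hρ₃'), fun k m hk => ?_⟩
  have hT₀lam : T₀.lam = lam := rfl
  have mono : ∀ {C ρ' : ℝ}, 0 < C → 0 < ρ' → ρ' ≤ ρ →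
      C * (ρ' * T₀.lam) ^ (k + m) ≤ C * (ρ * T₀.lam) ^ (k + m) := by
    intro C ρ' hC hρ' hle
    rw [hT₀lam]
    gcongr
  have hsub : (words (k + m)).filter (fun w =>
      ¬ ((cornerDist (w.drop m) : ℝ) ≤ η * (k + m : ℕ) ∧
        ∀ o, |(extent (w.drop m) o : ℝ) - 1 / (2 * P * lam) * k| ≤ η * (k + m : ℕ))) ⊆
      ((words (k + m)).filter (fun w => η * (k + m : ℕ) ≤ cornerDist (w.drop m))) ∪
      (((words (k + m)).filter (fun w => P * η * (k + m : ℕ) ≤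
        |P * extent (w.drop m) true + P * extent (w.drop m) false - 1 / lam * k|)) ∪
      ((words (k + m)).filter (fun w => |κ| * η * (k + m : ℕ) ≤
        |κ * extent (w.drop m) true + -κ * extent (w.drop m) false - 0 * k|))) := by
    intro w hw
    simp only [Finset.mem_union, Finset.mem_filter] at hw ⊢
    obtain ⟨hw, hn⟩ := hw
    by_contra hcon
    push Not at hcon
    obtain ⟨n1, n2, n3⟩ := hcon
    have n1 := (n1 hw).le
    have n2 := (n2 hw).le
    have n3 := (n3 hw).le
    set e := (extent (w.drop m) true : ℝ)
    set f := (extent (w.drop m) false : ℝ)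
    have e2 : P * e + P * f - 1 / lam * k = P * (e + f - 2 * (1 / (2 * P * lam) * k)) := by
      field_simp
    have e3 : κ * e + -κ * f - 0 * k = κ * (e - f) := by ring
    rw [e2, abs_mul, abs_of_pos hP, mul_assoc P η] at n2
    rw [e3, abs_mul, mul_assoc |κ| η] at n3
    have n2 := abs_le.1 (le_of_mul_le_mul_left n2 hP)
    have n3 := abs_le.1 (le_of_mul_le_mul_left n3 (abs_pos.2 hκ))
    refine hn ⟨n1, ?_⟩
    rintro (_ | _) <;> rw [abs_le] <;> constructor <;> linarith
  have hle : (((words (k + m)).filter (fun w =>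
      ¬ ((cornerDist (w.drop m) : ℝ) ≤ η * (k + m : ℕ) ∧
        ∀ o, |(extent (w.drop m) o : ℝ) - 1 / (2 * P * lam) * k| ≤ η * (k + m : ℕ)))).card : ℝ) ≤
      (C₁ + C₂ + C₃) * (ρ * T₀.lam) ^ (k + m) := by
    have h := (Finset.card_le_card hsub).trans ((Finset.card_union_le _ _).trans
      (Nat.add_le_add_left (Finset.card_union_le _ _) _))
    have cast : ∀ a b c d : ℕ, a ≤ b + (c + d) → (a : ℝ) ≤ b + (c + d) := by
      intro a b c d; exact_mod_cast id
    have h' := cast _ _ _ _ h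
    have := (b₁ k m hk).trans (mono hC₁ hρ₁ l1)
    have := (b₂ k m hk).trans (mono hC₂ hρ₂ l2)
    have := (b₃ k m hk).trans (mono hC₃ hρ₃ l3)
    linarith
  refine hle.trans ?_
  have hcard' := hcard (k + m) (by omega)
  have hρ0 : 0 < ρ := hρ₁.trans_le l1
  rw [mul_pow]
  calc (C₁ + C₂ + C₃) * (ρ ^ (k + m) * T₀.lam ^ (k + m))
      = (C₁ + C₂ + C₃) / c₀ * ρ ^ (k + m) * (c₀ * T₀.lam ^ (k + m)) := by
        field_simp
    _ ≤ _ := mul_le_mul_of_nonneg_left hcard' (by positivity)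

/-! ### From the box to the path -/

lemma coord_add_gap_le_length (d : Dir) :
    ∀ w : List Dir, coord d (pos w) + gap w d ≤ w.length
  | [] => by obtain ⟨_ | _, _ | _⟩ := d <;> simp [coord, pos, gap]
  | e :: w => by
      have := coord_add_gap_le_length d w
      rw [coord_pos_cons, coord_vec, gap, List.length_cons]
      split_ifs <;> push_cast <;> omega

lemma coord_add_gap_nonneg (d : Dir) : ∀ w : List Dir, 0 ≤ coord d (pos w) + gap w d
  | [] => by obtain ⟨_ | _, _ | _⟩ := d <;> simp [coord, pos, gap]
  | e :: w => by
      have := coord_add_gap_nonneg d w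
      rw [coord_pos_cons, coord_vec, gap]
      split_ifs <;> push_cast <;> omega

/-- A side of the box that is not touched does not move. -/
lemma coord_add_gap_cons {w : List Dir} {d : Dir} (h : gap w d ≠ 0) (e : Dir) :
    coord d (pos (e :: w)) + gap (e :: w) d = coord d (pos w) + gap w d := by
  rw [coord_pos_cons, coord_vec, gap]
  split_ifs <;> push_cast <;> omega

lemma gap_cons_le (w : List Dir) (d e : Dir) : gap (e :: w) d ≤ gap w d + 1 := by
  rw [gap]; split_ifs <;> omega

lemma exists_drop_eq_cons {L k : ℕ} {w : List Dir} (hw : w.length = L) (hk : k < L) :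
    ∃ e, w.drop (L - (k + 1)) = e :: w.drop (L - k) := by
  have h : L - (k + 1) < w.length := by omega
  refine ⟨w[L - (k + 1)], ?_⟩
  rw [List.drop_eq_getElem_cons h, show L - (k + 1) + 1 = L - k by omega]

/-- If the path stays near the corners of a box that grows linearly, then in each coordinate it
stays near one and the same side of the box from a small time on, because the box is too large for
the path to change sides. The opposite side does not move any more, and the coordinate grows like
the extent of the box. -/
lemma exists_sign {c η : ℝ} (hc : 0 < c) {L : ℕ} (hL : 1 ≤ η * L) {w : List Dir}
    (hw : w.length = L) (o : Bool)
    (hcor : ∀ k, 1 ≤ k → k ≤ L → ∃ s, (gap (w.drop (L - k)) (o, s) : ℝ) ≤ η * L)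
    (hext : ∀ k, 1 ≤ k → k ≤ L → |(extent (w.drop (L - k)) o : ℝ) - c * k| ≤ η * L) :
    ∃ s, ∀ k, k ≤ L → |(coord (o, s) (pos (w.drop (L - k))) : ℝ) - c * k| ≤
      ((1 + c) * (4 / c + 1) + 3) * (η * L) := by
  set k₀ := ⌊4 * (η * L) / c⌋₊ + 1 with hk₀
  have h4 : 0 ≤ 4 * (η * L) / c := by positivity
  have hk₀le : (k₀ : ℝ) ≤ (4 / c + 1) * (η * L) := by
    have h1 := Nat.floor_le h4
    have h2 : 4 * (η * L) / c = 4 / c * (η * L) := by ring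
    rw [hk₀]; push_cast; linarith
  have hlarge : ∀ k : ℕ, k₀ ≤ k → 4 * (η * L) < c * k := by
    intro k hk
    have h1 : 4 * (η * L) / c < k₀ := by rw [hk₀]; push_cast; exact Nat.lt_floor_add_one _
    have h2 : (k₀ : ℝ) ≤ k := Nat.cast_le.2 hk
    rw [div_lt_iff₀ hc] at h1
    nlinarith
  have hM0 : 0 ≤ (4 / c + 1) * (η * L) := by positivity
  have hlen : ∀ k, k ≤ L → (w.drop (L - k)).length = k := by
    intro k hk; rw [List.length_drop, hw]; omega
  have early : ∀ s, ∀ k, k ≤ L → k < k₀ →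
      |(coord (o, s) (pos (w.drop (L - k))) : ℝ) - c * k| ≤
        ((1 + c) * (4 / c + 1) + 3) * (η * L) := by
    intro s k hk hlt
    have a1 := coord_add_gap_le_length (o, s) (w.drop (L - k))
    have a2 := coord_add_gap_le_length (opp (o, s)) (w.drop (L - k))
    rw [coord_opp] at a2
    rw [hlen k hk] at a1 a2
    have b1 : (coord (o, s) (pos (w.drop (L - k))) : ℝ) ≤ k := by
      exact_mod_cast (show coord (o, s) (pos (w.drop (L - k))) ≤ k by omega)
    have b2 : -(k : ℝ) ≤ coord (o, s) (pos (w.drop (L - k))) := by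
      exact_mod_cast (show -(k : ℤ) ≤ coord (o, s) (pos (w.drop (L - k))) by omega)
    have b3 : (k : ℝ) ≤ k₀ := Nat.cast_le.2 hlt.le
    have b4 : (0 : ℝ) ≤ c * k := by positivity
    have b5 := mul_le_mul_of_nonneg_left (b3.trans hk₀le) hc.le
    rw [abs_le]; constructor <;> linarith
  by_cases hkL : k₀ ≤ L
  swap
  · exact ⟨true, fun k hk => early true k hk (by omega)⟩
  obtain ⟨s, hs⟩ := hcor k₀ (by omega) hkL
  have hext' : ∀ k, k₀ ≤ k → k ≤ L → 3 * (η * L) < extent (w.drop (L - k)) o := by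
    intro k hk hkL
    have := (abs_le.1 (hext k (by omega) hkL)).1
    linarith [hlarge k hk]
  have hsum : ∀ v : List Dir, (gap v (o, s) : ℝ) + gap v (opp (o, s)) = extent v o := by
    intro v; exact_mod_cast gap_add_gap_opp v (o, s)
  have main : ∀ k, k₀ ≤ k → k ≤ L → (gap (w.drop (L - k)) (o, s) : ℝ) ≤ η * L ∧
      coord (opp (o, s)) (pos (w.drop (L - k))) + gap (w.drop (L - k)) (opp (o, s)) ≤ k₀ := by
    intro k hk
    induction k, hk using Nat.le_induction with
    | base =>
      intro _
      refine ⟨hs, ?_⟩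
      have := coord_add_gap_le_length (opp (o, s)) (w.drop (L - k₀))
      rwa [hlen k₀ hkL] at this
    | succ k hk ih =>
      intro hk1
      obtain ⟨ih1, ih2⟩ := ih (by omega)
      obtain ⟨e, he⟩ := exists_drop_eq_cons hw (show k < L by omega)
      have hbig := hext' k hk (by omega)
      have hbig1 := hext' (k + 1) (by omega) hk1
      constructor
      · obtain ⟨s', hs'⟩ := hcor (k + 1) (by omega) hk1
        by_cases hss : s' = s
        · rwa [hss] at hs'
        · have e1 : (o, s') = opp (o, s) := by
            rw [opp]; revert hss; cases s <;> cases s' <;> simp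
          rw [e1] at hs'
          have g1 : (gap (w.drop (L - (k + 1))) (o, s) : ℝ) ≤ gap (w.drop (L - k)) (o, s) + 1 := by
            rw [he]; exact_mod_cast gap_cons_le _ _ _
          have := hsum (w.drop (L - (k + 1)))
          linarith
      · have hne : gap (w.drop (L - k)) (opp (o, s)) ≠ 0 := by
          intro h0
          have := hsum (w.drop (L - k))
          rw [h0] at this
          push_cast at this
          linarith
        rw [he, coord_add_gap_cons hne]
        exact ih2
  refine ⟨s, fun k hk => ?_⟩
  rcases lt_or_ge k k₀ with hlt | hge
  · exact early s k hk hlt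
  · obtain ⟨m1, m2⟩ := main k hge hk
    have m3 := coord_add_gap_nonneg (opp (o, s)) (w.drop (L - k))
    have m4 := abs_le.1 (hext k (by omega) hk)
    have m5 := hsum (w.drop (L - k))
    have m6 : (0 : ℝ) ≤ gap (w.drop (L - k)) (o, s) := Nat.cast_nonneg _
    rw [coord_opp] at m2 m3
    have m2' : -(coord (o, s) (pos (w.drop (L - k))) : ℝ) + gap (w.drop (L - k)) (opp (o, s)) ≤
        k₀ := by exact_mod_cast m2
    have m3' : 0 ≤ -(coord (o, s) (pos (w.drop (L - k))) : ℝ) +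
        gap (w.drop (L - k)) (opp (o, s)) := by exact_mod_cast m3
    have m7 : 0 ≤ c * ((4 / c + 1) * (η * L)) := by positivity
    rw [abs_le]; constructor <;> linarith

/-! ### Words and lattice paths -/

/-- The lattice path coded by a word with `L` letters. -/
def toPath (L : ℕ) (w : List Dir) : LatticePath L := fun i => pos (w.drop (L - i))

lemma prudent_drop : ∀ (n : ℕ) {w : List Dir}, Prudent w → Prudent (w.drop n)
  | 0, _, h => h
  | _ + 1, [], h => h
  | n + 1, _ :: _, h => prudent_drop n h.1

lemma mem_visited_iff : ∀ {w : List Dir} {v : ℤ × ℤ},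
    v ∈ visited w ↔ ∃ n ≤ w.length, v = pos (w.drop n)
  | [], v => by simp [visited, pos]
  | d :: w, v => by
      rw [visited, Set.mem_insert_iff, mem_visited_iff]
      constructor
      · rintro (h | ⟨n, hn, h⟩)
        · exact ⟨0, Nat.zero_le _, h⟩
        · exact ⟨n + 1, by simpa using hn, h⟩
      · rintro ⟨_ | n, hn, h⟩
        · exact Or.inl h
        · exact Or.inr ⟨n, by simpa using hn, h⟩

lemma vec_mem_unitSteps (d : Dir) : vec d ∈ unitSteps := by
  obtain ⟨_ | _, _ | _⟩ := d <;> simp [vec, unitSteps]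

lemma exists_vec_eq {v : ℤ × ℤ} (h : v ∈ unitSteps) : ∃ d, vec d = v := by
  rcases h with rfl | rfl | rfl | rfl
  · exact ⟨(false, true), rfl⟩
  · exact ⟨(false, false), rfl⟩
  · exact ⟨(true, true), rfl⟩
  · exact ⟨(true, false), rfl⟩

lemma vec_injective : Function.Injective vec := by
  rintro ⟨_ | _, _ | _⟩ ⟨_ | _, _ | _⟩ h <;> simp [vec] at h ⊢

lemma toPath_cons_castSucc (L : ℕ) (d : Dir) (w : List Dir) (i : Fin (L + 1)) :
    toPath (L + 1) (d :: w) i.castSucc = toPath L w i := by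
  rw [toPath, toPath, Fin.val_castSucc, show L + 1 - (i : ℕ) = L - i + 1 by omega,
    List.drop_succ_cons]

lemma toPath_last (L : ℕ) (w : List Dir) : toPath L w (Fin.last L) = pos w := by
  simp [toPath]

lemma isPrudent_toPath {L : ℕ} {w : List Dir} (hw : w ∈ words L) : IsPrudent (toPath L w) := by
  obtain ⟨hlen, hp⟩ := mem_words.1 hw
  have hstep : ∀ i : Fin L, ∃ e, w.drop (L - (i + 1)) = e :: w.drop (L - i) := fun i =>
    exists_drop_eq_cons hlen i.2
  have hdiff : ∀ (i : Fin L) (e : Dir), w.drop (L - (i + 1)) = e :: w.drop (L - i) →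
      toPath L w i.succ - toPath L w i.castSucc = vec e := by
    intro i e he
    simp only [toPath, Fin.val_succ, Fin.val_castSucc, he, pos]
    abel
  refine ⟨?_, fun i => ?_, fun i n hn j hj => ?_⟩
  · simp [toPath, ← hlen, pos]
  · obtain ⟨e, he⟩ := hstep i
    rw [hdiff i e he]
    exact vec_mem_unitSteps e
  · obtain ⟨e, he⟩ := hstep i
    rw [hdiff i e he]
    have hpr := prudent_drop (L - (i + 1)) hp
    rw [he] at hpr
    intro heq
    refine hpr.2 n hn ?_
    change toPath L w i.castSucc + n • vec e ∈ _
    have hj' : (j : ℕ) ≤ i := hj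
    rw [heq, mem_visited_iff]
    refine ⟨i - j, by rw [List.length_drop]; omega, ?_⟩
    rw [List.drop_drop, show L - (i : ℕ) + (i - j) = L - j by omega]
    rfl

lemma exists_word : ∀ {L : ℕ} {π : LatticePath L}, IsPrudent π → ∃ w ∈ words L, toPath L w = π
  | 0, π, h => ⟨[], by simp [words], by
      funext i
      obtain rfl : i = 0 := Fin.ext (by omega)
      rw [h.start]; rfl⟩
  | L + 1, π, h => by
      have h' : IsPrudent (L := L) (fun i => π i.castSucc) :=
        ⟨h.start, fun i => h.step i.castSucc, fun i n hn j hj =>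
          h.prudent i.castSucc n hn j.castSucc hj⟩
      obtain ⟨w, hw, hwπ⟩ := exists_word h'
      obtain ⟨d, hd⟩ := exists_vec_eq (h.step (Fin.last L))
      obtain ⟨hlen, hp⟩ := mem_words.1 hw
      have hpos : pos w = π (Fin.last L).castSucc := by
        rw [← toPath_last L w, hwπ]
      refine ⟨d :: w, mem_words.2 ⟨by simp [hlen], hp, ?_⟩, ?_⟩
      · intro n hn hv
        obtain ⟨m, hm, hvm⟩ := mem_visited_iff.1 hv
        refine h.prudent (Fin.last L) n hn (⟨L - m, by omega⟩ : Fin (L + 1)).castSucc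
          (Fin.le_last (⟨L - m, by omega⟩ : Fin (L + 1))) ?_
        rw [← hd, ← hpos, hvm]
        have := congrFun hwπ ⟨L - m, by omega⟩
        rw [← this, toPath]
        congr 2
        simp only
        omega
      · funext i
        refine Fin.lastCases ?_ (fun j => ?_) i
        · rw [toPath_last, pos, hd, hpos, ← Fin.succ_last]
          abel
        · rw [toPath_cons_castSucc, hwπ]

lemma toPath_injOn : ∀ {L : ℕ} {w w' : List Dir}, w.length = L → w'.length = L →
    toPath L w = toPath L w' → w = w'
  | 0, w, w', h, h', _ => by
      rw [List.length_eq_zero_iff.1 h, List.length_eq_zero_iff.1 h']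
  | L + 1, d :: w, d' :: w', h, h', heq => by
      have ht : w = w' := toPath_injOn (by simpa using h) (by simpa using h') (by
        funext i
        rw [← toPath_cons_castSucc L d w, ← toPath_cons_castSucc L d' w', heq])
      subst ht
      have hl := congrFun heq (Fin.last (L + 1))
      rw [toPath_last, toPath_last, pos, pos] at hl
      rw [vec_injective (add_left_cancel hl)]

open Classical in
lemma prudentPaths_eq (L : ℕ) : prudentPaths L = ((words L).image (toPath L) : Finset _) := by
  ext π
  rw [Finset.coe_image]
  constructor
  · exact fun h => exists_word h
  · rintro ⟨w, hw, rfl⟩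
    exact isPrudent_toPath hw

lemma words_nonempty : ∀ L, (words L).Nonempty
  | 0 => ⟨[], mem_words.2 ⟨rfl, trivial⟩⟩
  | L + 1 => by
      obtain ⟨w, hw⟩ := words_nonempty L
      obtain ⟨hlen, hp⟩ := mem_words.1 hw
      cases w with
      | nil =>
        exact ⟨[(true, true)], mem_words.2 ⟨by simp [← hlen], hp, allowed_of_gap_eq_zero rfl⟩⟩
      | cons e w =>
        exact ⟨e :: e :: w, mem_words.2 ⟨by simp [← hlen], hp, allowed_straight hp.2⟩⟩

open Classical in
/-- Probabilities under the uniform law are ratios of numbers of prudent words. -/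
lemma uniformLaw_apply (L : ℕ) (S : Set (LatticePath L)) :
    uniformLaw L S = ENNReal.ofReal
      (((words L).filter (fun w => toPath L w ∈ S)).card / (words L).card) := by
  have hinj : Set.InjOn (toPath L) (words L) := fun w hw w' hw' h =>
    toPath_injOn (mem_words.1 hw).1 (mem_words.1 hw').1 h
  have hinter : prudentPaths L ∩ S =
      (((words L).filter (fun w => toPath L w ∈ S)).image (toPath L) : Finset _) := by
    rw [prudentPaths_eq]
    ext π
    simp only [Set.mem_inter_iff, Finset.coe_image, Finset.coe_filter, Set.mem_image,
      Finset.mem_coe, Set.mem_ofPred_eq]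
    constructor
    · rintro ⟨⟨w, hw, rfl⟩, hS⟩
      exact ⟨w, ⟨hw, hS⟩, rfl⟩
    · rintro ⟨w, ⟨hw, hS⟩, rfl⟩
      exact ⟨⟨w, hw, rfl⟩, hS⟩
  rw [uniformLaw, uniformOn, cond_apply (prudentPaths L).to_countable.measurableSet, hinter,
    prudentPaths_eq, MeasureTheory.Measure.count_apply_finset,
    MeasureTheory.Measure.count_apply_finset, Finset.card_image_of_injOn hinj,
    Finset.card_image_of_injOn (hinj.mono (Finset.coe_subset.2 (Finset.filter_subset _ _)))]
  have hpos : (0 : ℝ) < (words L).card := Nat.cast_pos.2 (words_nonempty L).card_pos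
  rw [ENNReal.ofReal_div_of_pos hpos, ENNReal.ofReal_natCast, ENNReal.ofReal_natCast,
    ENNReal.div_eq_inv_mul]

/-! ### The interpolated path -/

/-- A bound for the coordinates at integer times carries over to the interpolation. -/
lemma abs_interpolation_le {X : ℕ → ℝ} {c M : ℝ} {L : ℕ}
    (hX : ∀ k, k ≤ L → |X k - c * k| ≤ M) {x : ℝ} (hx0 : 0 ≤ x) (hxL : x ≤ L) :
    |X (min ⌊x⌋₊ L) + (x - ⌊x⌋₊) * (X (min (⌊x⌋₊ + 1) L) - X (min ⌊x⌋₊ L)) - c * x| ≤ M := by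
  have hn : ⌊x⌋₊ ≤ L := by
    have := Nat.floor_le_floor hxL
    rwa [Nat.floor_natCast] at this
  have hf0 : 0 ≤ x - ⌊x⌋₊ := sub_nonneg.2 (Nat.floor_le hx0)
  have hf1 : 0 ≤ 1 - (x - ⌊x⌋₊) := by linarith [Nat.lt_floor_add_one x]
  have h1 := abs_le.1 (hX _ hn)
  rw [min_eq_left hn]
  rcases Nat.lt_or_ge ⌊x⌋₊ L with hlt | hge
  · have h2 := abs_le.1 (hX _ (show ⌊x⌋₊ + 1 ≤ L from hlt))
    rw [min_eq_left (show ⌊x⌋₊ + 1 ≤ L from hlt)]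
    push_cast at h2
    rw [abs_le]
    constructor <;> nlinarith [mul_le_mul_of_nonneg_left h1.1 hf1,
      mul_le_mul_of_nonneg_left h1.2 hf1, mul_le_mul_of_nonneg_left h2.1 hf0,
      mul_le_mul_of_nonneg_left h2.2 hf0]
  · have hL : ⌊x⌋₊ = L := le_antisymm hn hge
    have hx : x = ⌊x⌋₊ := by
      refine le_antisymm ?_ (Nat.floor_le hx0)
      rw [hL]; exact hxL
    rw [← hx, sub_self, zero_mul, add_zero]
    rw [← hx] at h1
    exact abs_le.2 h1

lemma norm_le_add_abs (v : EuclideanSpace ℝ (Fin 2)) : ‖v‖ ≤ |v 0| + |v 1| := by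
  rw [EuclideanSpace.norm_eq, Fin.sum_univ_two, Real.norm_eq_abs, Real.norm_eq_abs]
  refine Real.sqrt_le_iff.2 ⟨by positivity, ?_⟩
  nlinarith [mul_nonneg (abs_nonneg (v 0)) (abs_nonneg (v 1))]

lemma coord_eq_sign_mul (o s : Bool) (v : ℤ × ℤ) :
    (coord (o, s) v : ℝ) = (if s then 1 else -1) * ((if o then v.2 else v.1 : ℤ) : ℝ) := by
  cases o <;> cases s <;> simp [coord]

/-- If both signed coordinates of the path grow linearly at all times, then the rescaled path is
uniformly close to a diagonal. -/
lemma exists_diagonal {c M : ℝ} {L : ℕ} (hL : 0 < L) {w : List Dir}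
    (h : ∀ o, ∃ s, ∀ k, k ≤ L → |(coord (o, s) (pos (w.drop (L - k))) : ℝ) - c * k| ≤ M * L) :
    ∃ i : Fin 4, ∀ t ∈ Set.Icc (0 : ℝ) 1,
      ‖rescaledPath (toPath L w) t - (c * t) • diagonal i‖ ≤ 2 * M := by
  have hL' : (0 : ℝ) < L := Nat.cast_pos.2 hL
  -- `X o` is the coordinate along the axis `o`.
  set X : Bool → ℕ → ℝ := fun o k =>
    ((if o then (pos (w.drop (L - k))).2 else (pos (w.drop (L - k))).1 : ℤ) : ℝ) with hX
  have coordX : ∀ o s t, t ∈ Set.Icc (0 : ℝ) 1 →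
      (∀ k, k ≤ L → |(coord (o, s) (pos (w.drop (L - k))) : ℝ) - c * k| ≤ M * L) →
      |1 / (L : ℝ) * (X o (min ⌊t * L⌋₊ L) + (t * L - ⌊t * L⌋₊) *
        (X o (min (⌊t * L⌋₊ + 1) L) - X o (min ⌊t * L⌋₊ L))) -
        c * t * (if s then 1 else -1)| ≤ M := by
    intro o s t ht hk
    set σ : ℝ := if s then 1 else -1 with hσ
    have hσσ : σ * σ = 1 := by rw [hσ]; cases s <;> norm_num
    have hσabs : |σ| = 1 := by rw [hσ]; cases s <;> norm_num
    have := abs_interpolation_le (X := fun k => σ * X o k) (c := c) (M := M * L) (L := L)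
      (fun k hkL => by rw [← coord_eq_sign_mul]; exact hk k hkL)
      (mul_nonneg ht.1 hL'.le) (mul_le_of_le_one_left hL'.le ht.2)
    rw [← div_le_iff₀ hL', ← abs_of_pos hL', ← abs_div, abs_of_pos hL'] at this
    refine le_trans (le_of_eq ?_) this
    have habs : ∀ y, |y| = |σ * y| := fun y => by rw [abs_mul, hσabs, one_mul]
    rw [habs]
    congr 1
    field_simp
    linear_combination (-(c * t * L)) * hσσ
  have hposition : ∀ n, position (toPath L w) n = !₂[X false (min n L), X true (min n L)] := by
    intro n; simp [position, toPath, hX]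
  obtain ⟨s₀, h₀⟩ := h false
  obtain ⟨s₁, h₁⟩ := h true
  have hdiag : ∃ i : Fin 4, diagonal i = !₂[if s₀ then 1 else -1, if s₁ then 1 else -1] := by
    cases s₀ <;> cases s₁
    · exact ⟨2, by simp [diagonal]⟩
    · exact ⟨1, by simp [diagonal]⟩
    · exact ⟨3, by simp [diagonal]⟩
    · exact ⟨0, by simp [diagonal]⟩
  obtain ⟨i, hi⟩ := hdiag
  refine ⟨i, fun t ht => ?_⟩
  have b₀ := coordX false s₀ t ht h₀
  have b₁ := coordX true s₁ t ht h₁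
  refine (norm_le_add_abs _).trans ?_
  rw [hi, rescaledPath, hposition, hposition]
  simp only [PiLp.sub_apply, PiLp.smul_apply, PiLp.add_apply, smul_eq_mul,
    Matrix.cons_val_zero, Matrix.cons_val_one]
  linarith

end PrudentWalk

open PrudentWalk in
theorem theorem1 :
    ∃ c : ℝ, 0 < c ∧ ∀ ε : ℝ, 0 < ε →
      Tendsto
        (fun L : ℕ => PrudentWalk.uniformLaw L
          {π : PrudentWalk.LatticePath L | ∃ i : Fin 4, ∀ t ∈ Set.Icc (0 : ℝ) 1,
            ‖PrudentWalk.rescaledPath π t - (c * t) • PrudentWalk.diagonal i‖ ≤ ε})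
        atTop (𝓝 1) := by
  classical
  obtain ⟨c, hc, hconc⟩ := exists_concentration
  refine ⟨c, hc, fun ε hε => ?_⟩
  -- The deviation at integer times is at most `N * η * L`, where `2 * N * η = ε`.
  set N := (1 + c) * (4 / c + 1) + 3 with hN
  have hN0 : 0 < N := by positivity
  set η := ε / (2 * N) with hη
  have hη0 : 0 < η := by positivity
  have hNη : 2 * (N * η) = ε := by rw [hη]; field_simp
  obtain ⟨C, hC, ρ, hρ0, hρ1, hbound⟩ := hconc η hη0
  set good : (L : ℕ) → Set (LatticePath L) := fun L => {π : LatticePath L | ∃ i : Fin 4,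
    ∀ t ∈ Set.Icc (0 : ℝ) 1, ‖rescaledPath π t - (c * t) • diagonal i‖ ≤ ε} with hgood
  -- The event of `exists_concentration` at time `k`.
  set near : ℕ → ℕ → List Dir → Prop := fun L k w =>
    (cornerDist (w.drop (L - k)) : ℝ) ≤ η * L ∧
      ∀ o, |(extent (w.drop (L - k)) o : ℝ) - c * k| ≤ η * L with hnear
  have hgoodword : ∀ L : ℕ, 0 < L → 1 ≤ η * L → ∀ w ∈ words L,
      (∀ k, 1 ≤ k → k ≤ L → near L k w) → toPath L w ∈ good L := by
    intro L hL0 hL w hw hall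
    obtain ⟨hlen, hp⟩ := mem_words.1 hw
    have hsign := fun o => exists_sign hc hL hlen o (fun k hk hkL => by
      have hcd := (hall k hk hkL).1
      obtain ⟨j, rfl⟩ := Nat.exists_eq_add_of_le' hk
      obtain ⟨e, he⟩ := exists_drop_eq_cons hlen (show j < L by omega)
      have hpr := prudent_drop (L - (j + 1)) hp
      rw [he] at hpr hcd ⊢
      have h0 := (prudent_structure _ _ hpr).1
      set v := e :: w.drop (L - j)
      by_cases ho : o = (normal v).1
      · refine ⟨(normal v).2, ?_⟩
        rw [ho, Prod.mk.eta, h0, Nat.cast_zero]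
        positivity
      · rw [cornerDist, Nat.cast_min, min_le_iff] at hcd
        rcases hcd with h | h
        · exact ⟨true, by rwa [perp, ← Bool.eq_not.2 ho] at h⟩
        · exact ⟨false, by rwa [opp, perp, ← Bool.eq_not.2 ho] at h⟩)
      (fun k hk hkL => (hall k hk hkL).2 o)
    have := exists_diagonal (M := N * η) hL0 (fun o => by
      obtain ⟨s, hs⟩ := hsign o
      exact ⟨s, fun k hk => (hs k hk).trans_eq (by ring)⟩)
    rwa [hNη] at this
  -- A union bound over the times.
  have hratio : ∀ᶠ L : ℕ in atTop, 1 - C * (L * ρ ^ L) ≤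
      (((words L).filter (fun w => toPath L w ∈ good L)).card : ℝ) / (words L).card := by
    have hev : ∀ᶠ L : ℕ in atTop, 1 / η ≤ (L : ℝ) :=
      tendsto_natCast_atTop_atTop.eventually_ge_atTop (1 / η)
    filter_upwards [hev, eventually_gt_atTop 0] with L hL hL0
    rw [div_le_iff₀' hη0] at hL
    have hpos : (0 : ℝ) < (words L).card := Nat.cast_pos.2 (words_nonempty L).card_pos
    have hsub : (words L).filter (fun w => ¬ toPath L w ∈ good L) ⊆
        (Finset.Icc 1 L).biUnion fun k => (words L).filter (fun w => ¬ near L k w) := by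
      intro w hw
      obtain ⟨hw, hbad⟩ := Finset.mem_filter.1 hw
      by_contra hcon
      refine hbad (hgoodword L hL0 hL w hw fun k hk hkL => ?_)
      by_contra hk'
      exact hcon (Finset.mem_biUnion.2 ⟨k, Finset.mem_Icc.2 ⟨hk, hkL⟩,
        Finset.mem_filter.2 ⟨hw, hk'⟩⟩)
    have hcard : (((words L).filter (fun w => ¬ toPath L w ∈ good L)).card : ℝ) ≤
        C * (L * ρ ^ L) * (words L).card := by
      calc (((words L).filter (fun w => ¬ toPath L w ∈ good L)).card : ℝ)
          ≤ ∑ k ∈ Finset.Icc 1 L, (((words L).filter (fun w => ¬ near L k w)).card : ℝ) := by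
            exact_mod_cast (Finset.card_le_card hsub).trans Finset.card_biUnion_le
        _ ≤ ∑ k ∈ Finset.Icc 1 L, C * ρ ^ L * (words L).card := by
            refine Finset.sum_le_sum fun k hk => ?_
            obtain ⟨hk1, hkL⟩ := Finset.mem_Icc.1 hk
            have := hbound k (L - k) hk1
            rwa [Nat.add_sub_cancel' hkL] at this
        _ = _ := by
            rw [Finset.sum_const, Nat.card_Icc, nsmul_eq_mul, Nat.add_sub_cancel]
            ring
    have hadd : (((words L).filter (fun w => toPath L w ∈ good L)).card : ℝ) +
        ((words L).filter (fun w => ¬ toPath L w ∈ good L)).card = (words L).card := by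
      exact_mod_cast Finset.card_filter_add_card_filter_not (fun w => toPath L w ∈ good L)
    rw [le_div_iff₀ hpos]
    linarith
  have hlim : Tendsto (fun L : ℕ => 1 - C * (L * ρ ^ L)) atTop (𝓝 1) := by
    have := ((tendsto_self_mul_const_pow_of_lt_one hρ0.le hρ1).const_mul C).const_sub 1
    simpa using this
  have hreal : Tendsto (fun L : ℕ =>
      (((words L).filter (fun w => toPath L w ∈ good L)).card : ℝ) / (words L).card)
      atTop (𝓝 1) :=
    tendsto_of_tendsto_of_tendsto_of_le_of_le' hlim tendsto_const_nhds hratio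
      (Eventually.of_forall fun L => div_le_one_of_le₀
        (Nat.cast_le.2 (Finset.card_le_card (Finset.filter_subset _ _))) (Nat.cast_nonneg _))
  have := ENNReal.tendsto_ofReal hreal
  rw [ENNReal.ofReal_one] at this
  refine this.congr fun L => ?_
  convert (uniformLaw_apply L (good L)).symm
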